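/- Let $\mathbb R_+=[0,\infty)$. Define subsets $T_n\subset\mathbb R^n$ inductively by $T_0=\emptyset$, $T_1=\{0\}$ and $T_n=(\mathbb R^{n-1}\times\{0\})\cup(T_{n-1}\times\mathbb R_+)\subset\mathbb R^n$ for $n\ge 2$. For $n\ge 1$, a subset $C\subset\mathbb R^n$ is called *T-shaped* if there is an affine transformation (that is, an invertible affine map) $f:\mathbb R^n\to\mathbb R\times\mathbb R^{n-1}$ with $f(C)\subset\mathbb R\times T_{n-1}$. Let $t(\mathbb R^n)$ denote the smallest cardinality of a subset of $\mathbb R^n$ that is not T-shaped. Then: 1. $t(\mathbb R^1)=1$; 2. $t(\mathbb R^2)=3$; 3. $t(\mathbb R^3)=6$; 4. $t(\mathbb R^4)=12$; 5. $t(\mathbb R^n)\le n^2-n+1$ for every $n\ge 1$; 6. $t(\mathbb R^n)\ge t(\mathbb R^{n-1})+n+1$ for every $n\ge 4$; 7. $t(\mathbb R^n)\ge\frac12(n^2+3n-4)$ for every $n\ge 4$. -/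

import Mathlib

/-- The set `T_n ⊆ ℝⁿ`: `T_0 = ∅`, `T_1 = {0}` and
`T_n = (ℝⁿ⁻¹ × {0}) ∪ (T_{n-1} × [0, ∞))` for `n ≥ 2`, where the last factor of
`ℝⁿ = ℝⁿ⁻¹ × ℝ` is the last coordinate. -/
def TSet : (n : ℕ) → Set (Fin n → ℝ)
  | 0 => ∅
  | 1 => {0}
  | n + 2 => {x | x (Fin.last (n + 1)) = 0} ∪
      {x | (fun i : Fin (n + 1) => x i.castSucc) ∈ TSet (n + 1) ∧ 0 ≤ x (Fin.last (n + 1))}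

/-- A subset `C ⊆ ℝⁿ` (`n ≥ 1`) is T-shaped if `f(C) ⊆ ℝ × T_{n-1}` for some affine
transformation (invertible affine map) `f : ℝⁿ → ℝ × ℝⁿ⁻¹`. -/
def IsTShaped {n : ℕ} (C : Set (Fin n → ℝ)) : Prop :=
  ∃ f : (Fin n → ℝ) ≃ᵃ[ℝ] (ℝ × (Fin (n - 1) → ℝ)),
    f '' C ⊆ (Set.univ : Set ℝ) ×ˢ TSet (n - 1)

/-- `t(ℝⁿ)`: the smallest cardinality of a subset of `ℝⁿ` which is not T-shaped.
The value lies in `ℕ∞`, so it would be `⊤` if no finite subset failed to be T-shaped. -/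
noncomputable def tNumber (n : ℕ) : ℕ∞ :=
  sInf {k : ℕ∞ | ∃ A : Set (Fin n → ℝ), ¬ IsTShaped A ∧ A.encard = k}

/-! ### T-shapedness as successive peeling by affine functionals -/

open Module

/-! By `isTShaped_iff`, a T-shaped set in dimension n can be peeled by n - 1 functionals with
independent linear parts. The last one is nonnegative on the set and its zeros are discarded, the
one before it does the same to what remains, and so on; the first must vanish on all points still
left.

Upper bounds. Peeling covers the set by n - 1 hyperplanes, and a hyperplane meets the moment curve
in at most n points, so n(n - 1) + 1 points of that curve cannot be peeled. For n = 3 and n = 4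
explicit symmetric sets do better. If g ≥ 0 and gk = 0 at the vertices of an octahedron, then some
nontrivial combination of the linear parts of g and k vanishes on its diagonals
(`exists_comb_of_octahedron`). In dimension 3 this contradicts independence at once. In dimension 4
many sextuples of `twelvePoints` are octahedra in hyperplanes; those surviving the first peel
constrain the common kernel of g and k until the first functional must vanish there too.

Lower bounds. A facet of a set that is not T-shaped has at least n points, and at least t(n - 1)
points lie off it, since otherwise they could be projected and peeled by induction. Hence t(n) ≥ t(n
- 1) + n. If the set has fewer than 2t(n - 1) points, the points off the facet lie on several
parallel levels, so a projection can merge two of them, which gains one more point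
(`lt_card_pos_of_not_isTShaped`).

For n = 4 this gives only 11. A bad set of 11 points has 4 points on each facet and 7 off it.
Dimension counts force those 7 to be a pyramid over an octahedron (`exists_octahedron`). Comparing
adjacent facets shows that every vertex of the facet is the reflection of the apex in the
octahedron's centre (`apex_add_vertex`), which is absurd for four distinct vertices. -/

theorem mem_TSet_succ {m : ℕ} (x : Fin (m + 1) → ℝ) :
    x ∈ TSet (m + 1) ↔ x (Fin.last m) = 0 ∨
      ((fun i : Fin m => x i.castSucc) ∈ TSet m ∧ 0 ≤ x (Fin.last m)) := by
  cases m with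
  | zero =>
    simp only [TSet, Set.mem_singleton_iff, Set.mem_empty_iff_false, false_and, or_false]
    constructor
    · rintro rfl; rfl
    · intro h; funext i; fin_cases i; exact h
  | succ m => rfl

theorem eq_zero_of_linearIndependent_dual {V : Type*} [AddCommGroup V] [Module ℝ V]
    [FiniteDimensional ℝ V] {ι : Type*} [Fintype ι] {f : ι → V →ₗ[ℝ] ℝ}
    (hf : LinearIndependent ℝ f) (hc : Fintype.card ι = finrank ℝ V) {x : V}
    (hx : ∀ i, f i x = 0) : x = 0 := by
  have hspan : Submodule.span ℝ (Set.range f) = ⊤ :=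
    hf.span_eq_top_of_card_eq_finrank' (by rw [hc]; exact (Subspace.dual_finrank_eq).symm)
  refine (Module.forall_dual_apply_eq_zero_iff ℝ x).1 fun φ => ?_
  have hφ : φ ∈ Submodule.span ℝ (Set.range f) := hspan ▸ Submodule.mem_top
  induction hφ using Submodule.span_induction with
  | mem y hy => obtain ⟨i, rfl⟩ := hy; exact hx i
  | zero => rfl
  | add y z _ _ hy hz => simp [hy, hz]
  | smul a y _ hy => simp [hy]

/-- A set in `ℝ^(m+1)` is T-shaped iff some `m` affine functionals with linearly independent
linear parts send it into `T_m`. -/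
theorem isTShaped_iff {m : ℕ} {C : Set (Fin (m + 1) → ℝ)} :
    IsTShaped C ↔ ∃ g : Fin m → ((Fin (m + 1) → ℝ) →ᵃ[ℝ] ℝ),
      LinearIndependent ℝ (fun i => (g i).linear) ∧ ∀ c ∈ C, (fun i => g i c) ∈ TSet m := by
  constructor
  · rintro ⟨f, hf⟩
    let q : (ℝ × (Fin m → ℝ)) →ₗ[ℝ] (Fin m → ℝ) := LinearMap.snd ℝ ℝ (Fin m → ℝ)
    refine ⟨fun i => ((LinearMap.proj i).comp q).toAffineMap.comp f.toAffineMap, ?_, ?_⟩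
    · rw [Fintype.linearIndependent_iff]
      intro w hw j
      obtain ⟨y, hy⟩ := f.linear.surjective ((0 : ℝ), Pi.single j (1 : ℝ))
      have := congrArg (fun φ : (Fin (m + 1) → ℝ) →ₗ[ℝ] ℝ => φ y) hw
      simp only [LinearMap.sum_apply, LinearMap.smul_apply, LinearMap.zero_apply] at this
      have h2 : ∀ i, ((((LinearMap.proj i).comp q).toAffineMap.comp
          f.toAffineMap).linear y)
          = (Pi.single j (1 : ℝ) : Fin m → ℝ) i := by
        intro i
        change (f.linear y).2 i = _
        rw [hy]
      simp only [h2] at this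
      simpa [Pi.single_apply] using this
    · intro c hc
      exact (hf ⟨c, hc, rfl⟩).2
  · rintro ⟨g, hli, hg⟩
    -- The factor ℝ is unconstrained, so any functional completing the linear parts to a basis of
    -- the dual can serve as first coordinate.
    obtain ⟨e, he⟩ := exists_linearIndependent_cons_of_lt_finrank (R := ℝ) hli
      (by rw [Subspace.dual_finrank_eq]; simp)
    let G : (Fin (m + 1) → ℝ) →ₗ[ℝ] (ℝ × (Fin m → ℝ)) :=
      e.prod (LinearMap.pi fun i => (g i).linear)
    have hinj : Function.Injective G := by
      rw [← LinearMap.ker_eq_bot, LinearMap.ker_eq_bot']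
      intro x hx
      refine eq_zero_of_linearIndependent_dual he (by simp) fun i => ?_
      refine Fin.cases ?_ (fun j => ?_) i
      · exact congrArg Prod.fst hx
      · exact congrFun (congrArg Prod.snd hx) j
    let E := LinearEquiv.ofInjectiveOfFinrankEq G hinj (by simp; ring)
    refine ⟨E.toAffineEquiv.trans
      (AffineEquiv.constVAdd ℝ (ℝ × (Fin m → ℝ)) ((0 : ℝ), fun i => g i 0)), ?_⟩
    rintro _ ⟨c, hc, rfl⟩
    refine ⟨trivial, ?_⟩
    have key : (fun i => g i 0 + (g i).linear c) = fun i => g i c := by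
      funext i
      have := (g i).linearMap_vsub c 0
      simp at this
      linarith
    change (fun i => g i 0 + (g i).linear c) ∈ TSet m
    rw [key]
    exact hg c hc

theorem affineMap_sub {V : Type*} [AddCommGroup V] [Module ℝ V] (g : V →ᵃ[ℝ] ℝ) (x y : V) :
    g x - g y = g.linear (x - y) := by
  have := g.linearMap_vsub x y
  simpa using this.symm

theorem affineMap_eq {V : Type*} [AddCommGroup V] [Module ℝ V] (g : V →ᵃ[ℝ] ℝ) (x : V) :
    g x = g.linear x + g 0 := by
  have := affineMap_sub g x 0
  simp at this
  linarith

theorem affineMap_const {V : Type*} [AddCommGroup V] [Module ℝ V] {g : V →ᵃ[ℝ] ℝ}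
    (hg : g.linear = 0) (x y : V) : g x = g y := by
  have := affineMap_sub g x y
  rw [hg] at this
  simpa [sub_eq_zero] using this

/-! ### Peeling one supporting hyperplane and projecting the rest -/

theorem isTShaped_of_encard_lt {n : ℕ} {A : Set (Fin n → ℝ)} (h : A.encard < tNumber n) :
    IsTShaped A := by
  by_contra hA
  exact not_le.2 h (sInf_le ⟨A, hA, rfl⟩)

theorem le_tNumber {n : ℕ} {k : ℕ}
    (h : ∀ A : Finset (Fin n → ℝ), ¬ IsTShaped (A : Set (Fin n → ℝ)) → k ≤ A.card) :
    (k : ℕ∞) ≤ tNumber n := by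
  refine le_sInf ?_
  rintro _ ⟨A, hA, rfl⟩
  by_cases hfin : A.Finite
  · obtain ⟨B, rfl⟩ := hfin.exists_finset_coe
    rw [Set.encard_coe_eq_coe_finsetCard]
    exact_mod_cast h B hA
  · rw [Set.encard_eq_top_iff.2 hfin]
    exact le_top

/-- Functionals peeling the projection pull back to functionals that kill `v`, while `h` does not;
so adding `h` as the first peel preserves independence. -/
theorem isTShaped_of_projection {m : ℕ} {A : Set (Fin (m + 2) → ℝ)}
    {h : (Fin (m + 2) → ℝ) →ᵃ[ℝ] ℝ} {v : Fin (m + 2) → ℝ} (hv : h.linear v ≠ 0)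
    (hA : ∀ c ∈ A, 0 ≤ h c) {L : (Fin (m + 2) → ℝ) →ₗ[ℝ] (Fin (m + 1) → ℝ)}
    (hL : Function.Surjective L) (hLv : L v = 0)
    (hT : IsTShaped (L '' {c ∈ A | 0 < h c})) : IsTShaped A := by
  obtain ⟨g, hli, hg⟩ := isTShaped_iff.1 hT
  refine (isTShaped_iff (m := m + 1)).2
    ⟨Fin.snoc (α := fun _ => (Fin (m + 2) → ℝ) →ᵃ[ℝ] ℝ)
      (fun i => (g i).comp L.toAffineMap) h, ?_, ?_⟩
  · rw [Fintype.linearIndependent_iff]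
    intro w hw
    rw [Fin.sum_univ_castSucc] at hw
    simp only [Fin.snoc_castSucc, Fin.snoc_last, AffineMap.comp_linear,
      LinearMap.toAffineMap_linear] at hw
    have h1 : w (Fin.last m) = 0 := by
      have := congrArg (fun φ : (Fin (m + 2) → ℝ) →ₗ[ℝ] ℝ => φ v) hw
      simpa [hLv, hv] using this
    have h2 := Fintype.linearIndependent_iff.1 hli (fun i => w i.castSucc) (by
      ext1 y
      obtain ⟨x, hx⟩ := hL (Pi.single y 1)
      have := congrArg (fun φ : (Fin (m + 2) → ℝ) →ₗ[ℝ] ℝ => φ x) hw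
      simp only [h1, zero_smul, add_zero, LinearMap.sum_apply, LinearMap.smul_apply,
        LinearMap.comp_apply, hx, LinearMap.zero_apply] at this
      ext
      simpa using this)
    intro i
    exact Fin.lastCases h1 h2 i
  · intro c hc
    rw [mem_TSet_succ]
    simp only [Fin.snoc_castSucc, Fin.snoc_last, AffineMap.comp_apply, LinearMap.coe_toAffineMap]
    rcases (hA c hc).eq_or_lt with h0 | h0
    · exact Or.inl h0.symm
    · exact Or.inr ⟨hg _ ⟨c, ⟨hc, h0⟩, rfl⟩, h0.le⟩

theorem exists_projection {m : ℕ} {v : Fin (m + 2) → ℝ} (hv : v ≠ 0) :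
    ∃ L : (Fin (m + 2) → ℝ) →ₗ[ℝ] (Fin (m + 1) → ℝ), Function.Surjective L ∧ L v = 0 := by
  have hr : finrank ℝ ((Fin (m + 2) → ℝ) ⧸ Submodule.span ℝ {v}) =
      finrank ℝ (Fin (m + 1) → ℝ) := by
    have := Submodule.finrank_quotient_add_finrank (Submodule.span ℝ {v})
    rw [finrank_span_singleton hv] at this
    simp at this ⊢
    omega
  let E := LinearEquiv.ofFinrankEq _ _ hr
  refine ⟨E.toLinearMap.comp (Submodule.mkQ _), ?_, ?_⟩
  · exact E.surjective.comp (Submodule.mkQ_surjective _)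
  · simp [Submodule.mem_span_singleton_self]

open Classical in
theorem isTShaped_of_card_lt {m : ℕ} {A : Finset (Fin (m + 2) → ℝ)}
    {h : (Fin (m + 2) → ℝ) →ᵃ[ℝ] ℝ} (hh : h.linear ≠ 0) (hA : ∀ c ∈ A, 0 ≤ h c)
    (hc : ((A.filter (0 < h ·)).card : ℕ∞) < tNumber (m + 1)) :
    IsTShaped (A : Set (Fin (m + 2) → ℝ)) := by
  obtain ⟨v, hv⟩ : ∃ v, h.linear v ≠ 0 := by
    by_contra! hv
    exact hh (LinearMap.ext hv)
  obtain ⟨L, hL, hLv⟩ := exists_projection (v := v) (by rintro rfl; simp at hv)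
  refine isTShaped_of_projection hv hA hL hLv (isTShaped_of_encard_lt ?_)
  refine lt_of_le_of_lt (Set.encard_image_le _ _) ?_
  have : {c | c ∈ (A : Set (Fin (m + 2) → ℝ)) ∧ 0 < h c} =
      ((A.filter (0 < h ·) : Finset _) : Set _) := by
    ext; simp
  rwa [this, Set.encard_coe_eq_coe_finsetCard]

open Classical in
-- The direction `p - q` is transversal to the level sets of `h`, and projecting along it identifies
-- `p` with `q`, which saves one point.
theorem isTShaped_of_card_le {m : ℕ} {A : Finset (Fin (m + 2) → ℝ)}
    {h : (Fin (m + 2) → ℝ) →ᵃ[ℝ] ℝ} (hA : ∀ c ∈ A, 0 ≤ h c)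
    (hc : ((A.filter (0 < h ·)).card : ℕ∞) ≤ tNumber (m + 1))
    {p q : Fin (m + 2) → ℝ} (hp : p ∈ A.filter (0 < h ·)) (hq : q ∈ A.filter (0 < h ·))
    (hpq : h p ≠ h q) : IsTShaped (A : Set (Fin (m + 2) → ℝ)) := by
  have hv : h.linear (p - q) ≠ 0 := by
    rw [← affineMap_sub]; exact sub_ne_zero.2 hpq
  obtain ⟨L, hL, hLv⟩ := exists_projection (v := p - q) (by rintro h0; simp [h0] at hv)
  refine isTShaped_of_projection hv hA hL hLv (isTShaped_of_encard_lt ?_)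
  have : L '' {c | c ∈ (A : Set (Fin (m + 2) → ℝ)) ∧ 0 < h c} =
      ((((A.filter (0 < h ·)).erase q).image L : Finset _) : Set _) := by
    ext y
    simp only [Set.mem_image, Finset.coe_image, Finset.coe_erase, Finset.coe_filter]
    constructor
    · rintro ⟨x, hx, rfl⟩
      by_cases hxq : x = q
      · refine ⟨p, ⟨by simpa using hp, fun h0 => hpq (by rw [Set.mem_singleton_iff.1 h0])⟩, ?_⟩
        rw [hxq]
        exact sub_eq_zero.1 (by rw [← map_sub, hLv])
      · exact ⟨x, ⟨hx, hxq⟩, rfl⟩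
    · rintro ⟨x, hx, rfl⟩
      exact ⟨x, hx.1, rfl⟩
  rw [this, Set.encard_coe_eq_coe_finsetCard]
  refine lt_of_lt_of_le ?_ hc
  have h1 := Finset.card_image_le (s := (A.filter (0 < h ·)).erase q) (f := L)
  have h2 := Finset.card_erase_lt_of_mem hq
  exact_mod_cast h1.trans_lt h2

theorem isTShaped_of_subset_hyperplane {m : ℕ} {A : Set (Fin (m + 2) → ℝ)}
    {h : (Fin (m + 2) → ℝ) →ᵃ[ℝ] ℝ} (hh : h.linear ≠ 0) (hA : ∀ c ∈ A, h c = 0) :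
    IsTShaped A := by
  obtain ⟨v, hv⟩ : ∃ v, h.linear v ≠ 0 := by
    by_contra! hv
    exact hh (LinearMap.ext hv)
  obtain ⟨L, hL, hLv⟩ := exists_projection (v := v) (by rintro rfl; simp at hv)
  refine isTShaped_of_projection hv (fun c hc => (hA c hc).ge) hL hLv ?_
  have : {c | c ∈ A ∧ 0 < h c} = ∅ := by
    ext c
    simp only [Set.mem_ofPred_eq, Set.mem_empty_iff_false, iff_false, not_and, not_lt]
    exact fun hc => (hA c hc).le
  rw [this, Set.image_empty]
  obtain ⟨b⟩ : Nonempty ((Fin (m + 1) → ℝ) ≃ᵃ[ℝ] (ℝ × (Fin (m + 1 - 1) → ℝ))) :=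
    ⟨(LinearEquiv.ofFinrankEq _ _ (by simp; omega)).toAffineEquiv⟩
  exact ⟨b, by simp⟩

/-! ### General upper bound: the moment curve -/

theorem tNumber_le_of_family {n : ℕ} {ι : Type*} [Fintype ι] (f : ι → Fin n → ℝ)
    (hf : ¬ IsTShaped (Set.range f)) : tNumber n ≤ Fintype.card ι := by
  refine (sInf_le ⟨_, hf, rfl⟩ : tNumber n ≤ (Set.range f).encard).trans ?_
  rw [← Set.image_univ]
  refine (Set.encard_image_le _ _).trans ?_
  simp

theorem exists_eq_zero_of_mem_TSet : ∀ {m : ℕ} {x : Fin m → ℝ}, x ∈ TSet m → ∃ i, x i = 0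
  | 0, _, h => h.elim
  | m + 1, x, h => by
    rcases (mem_TSet_succ x).1 h with h | ⟨h, -⟩
    · exact ⟨_, h⟩
    · obtain ⟨i, hi⟩ := exists_eq_zero_of_mem_TSet h
      exact ⟨_, hi⟩

theorem affineMap_eq_sum {n : ℕ} (g : (Fin n → ℝ) →ᵃ[ℝ] ℝ) (x : Fin n → ℝ) :
    g x = g 0 + ∑ i, g.linear (Pi.single i 1) * x i := by
  rw [affineMap_eq g x, add_comm]
  congr 1
  conv_lhs => rw [LinearMap.pi_apply_eq_sum_univ g.linear x]
  exact Finset.sum_congr rfl fun i _ => by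
    rw [smul_eq_mul, mul_comm]
    congr 2
    funext j
    simp [Pi.single_apply, eq_comm]

/-- A hyperplane meets the moment curve in at most `n` points. -/
theorem card_moment_zeros_le {n : ℕ} (g : (Fin n → ℝ) →ᵃ[ℝ] ℝ) (hg : g.linear ≠ 0)
    (s : Finset ℕ) (hs : ∀ t ∈ s, g (fun i => (t : ℝ) ^ ((i : ℕ) + 1)) = 0) : s.card ≤ n := by
  classical
  let p : Polynomial ℝ := Polynomial.C (g 0) +
    ∑ i : Fin n, Polynomial.C (g.linear (Pi.single i 1)) * Polynomial.X ^ ((i : ℕ) + 1)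
  have hp : p ≠ 0 := by
    intro h0
    refine hg ?_
    refine LinearMap.pi_ext' fun i => LinearMap.ext_ring ?_
    have hc := congrArg (fun q => Polynomial.coeff q ((i : ℕ) + 1)) h0
    have hinj : ∀ j : Fin n, ((i : ℕ) = (j : ℕ)) ↔ i = j := fun j => Fin.ext_iff.symm
    simpa [p, Polynomial.finsetSum_coeff, Polynomial.coeff_C, Polynomial.coeff_X_pow,
      hinj] using hc
  have hdeg : p.natDegree ≤ n := by
    refine Polynomial.natDegree_add_le_of_degree_le (by simp) ?_
    refine Polynomial.natDegree_sum_le_of_forall_le _ _ fun i _ => ?_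
    exact (Polynomial.natDegree_C_mul_X_pow_le _ _).trans i.2
  calc s.card = (s.image (fun t : ℕ => (t : ℝ))).card :=
        (Finset.card_image_of_injective _ Nat.cast_injective).symm
    _ ≤ p.roots.toFinset.card := by
        refine Finset.card_le_card fun y hy => ?_
        obtain ⟨t, ht, rfl⟩ := Finset.mem_image.1 hy
        rw [Multiset.mem_toFinset, Polynomial.mem_roots hp, Polynomial.IsRoot.def]
        have := hs t ht
        rw [affineMap_eq_sum] at this
        simpa [p, Polynomial.eval_finsetSum] using this
    _ ≤ p.roots.card := Multiset.toFinset_card_le _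
    _ ≤ n := (Polynomial.card_roots' p).trans hdeg

theorem tNumber_le (n : ℕ) (hn : 1 ≤ n) : tNumber n ≤ ((n ^ 2 - n + 1 : ℕ) : ℕ∞) := by
  obtain ⟨m, rfl⟩ := Nat.exists_eq_succ_of_ne_zero (Nat.one_le_iff_ne_zero.1 hn)
  have key := tNumber_le_of_family
    (fun (t : Fin ((m + 1) ^ 2 - (m + 1) + 1)) (i : Fin (m + 1)) => ((t : ℕ) : ℝ) ^ ((i : ℕ) + 1)) ?_
  · simpa using key
  intro hT
  classical
  obtain ⟨g, hli, hg⟩ := isTShaped_iff.1 hT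
  let Z : Fin m → Finset ℕ := fun i => (Finset.range ((m + 1) ^ 2 - (m + 1) + 1)).filter
    fun t => g i (fun j => (t : ℝ) ^ ((j : ℕ) + 1)) = 0
  -- Each point is a zero of one of the `m` functionals, each of which has at most `m + 1` zeros
  -- here: one point too many.
  have h1 : Finset.range ((m + 1) ^ 2 - (m + 1) + 1) ⊆ Finset.univ.biUnion Z := by
    intro t ht
    obtain ⟨i, hi⟩ := exists_eq_zero_of_mem_TSet (hg _ ⟨⟨t, Finset.mem_range.1 ht⟩, rfl⟩)
    exact Finset.mem_biUnion.2 ⟨i, Finset.mem_univ _, Finset.mem_filter.2 ⟨ht, hi⟩⟩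
  have h2 := (Finset.card_le_card h1).trans (Finset.card_biUnion_le_card_mul _ _ (m + 1)
    fun i _ => card_moment_zeros_le (g i) (hli.ne_zero i) _ fun t ht => (Finset.mem_filter.1 ht).2)
  rw [Finset.card_range, Finset.card_univ, Fintype.card_fin] at h2
  have h3 : (m + 1) ^ 2 - (m + 1) = m * (m + 1) := by
    rw [pow_two, Nat.sub_eq_iff_eq_add (Nat.le_mul_self _)]; ring
  omega

/-! ### Octahedra, and the upper bound in dimension 3 -/

/-- Two functionals at a pair of points symmetric about `c`: the values at `c` are `gc`, `kc`,
the increments are `gq`, `kq`. -/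
theorem cross_eq_zero_of_pair {gc gq kc kq : ℝ} (hg : 0 < gc) (h1 : gc + gq = 0 ∨ kc + kq = 0)
    (h2 : gc - gq = 0 ∨ kc - kq = 0) : kc * gq + gc * kq = 0 := by
  rcases h1 with h1 | h1 <;> rcases h2 with h2 | h2
  · linarith
  · rw [eq_neg_of_add_eq_zero_right h1, ← sub_eq_zero.1 h2]; ring
  · rw [eq_neg_of_add_eq_zero_right h1, ← sub_eq_zero.1 h2]; ring
  · have : kc = 0 := by linarith
    have h : kq = 0 := by linarith
    simp [this, h]

/-- If `g ≥ 0` and `g k = 0` on an octahedron with centre `c` and half-diagonals `q i`, then a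
nontrivial combination of the linear parts of `g` and `k` vanishes on the half-diagonals. -/
theorem exists_comb_of_octahedron {ι : Type*} {gc kc : ℝ} {gq kq : ι → ℝ}
    (hg : ∀ i, 0 ≤ gc + gq i ∧ (gc + gq i = 0 ∨ kc + kq i = 0))
    (hg' : ∀ i, 0 ≤ gc - gq i ∧ (gc - gq i = 0 ∨ kc - kq i = 0)) :
    ∃ β γ : ℝ, ¬ (β = 0 ∧ γ = 0) ∧ ∀ i, β * gq i + γ * kq i = 0 := by
  rcases lt_or_ge 0 gc with h | h
  -- The product of the two functionals vanishes at both ends of a diagonal; the difference of the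
  -- two products is twice `kc * gq i + gc * kq i`.
  · exact ⟨kc, gc, fun h' => h.ne' h'.2,
      fun i => cross_eq_zero_of_pair h (hg i).2 (hg' i).2⟩
  · refine ⟨1, 0, by simp, fun i => ?_⟩
    have := (hg i).1
    have := (hg' i).1
    linarith

theorem tNumber_three_le : tNumber 3 ≤ 6 := by
  have key := tNumber_le_of_family
    (fun (i : Fin 3 × Bool) => (if i.2 then Pi.single i.1 1 else - Pi.single i.1 1 : Fin 3 → ℝ)) ?_
  · simpa using key
  intro hT
  obtain ⟨g, hli, hg⟩ := isTShaped_iff.1 hT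
  have hg' : ∀ x ∈ Set.range (fun (i : Fin 3 × Bool) =>
      (if i.2 then Pi.single i.1 1 else - Pi.single i.1 1 : Fin 3 → ℝ)),
      0 ≤ g 1 x ∧ (g 1 x = 0 ∨ g 0 x = 0) := by
    intro x hx
    have := hg x hx
    simp only [mem_TSet_succ] at this
    change (g 1 x = 0 ∨ (g 0 x = 0 ∨ _ ∈ TSet 0 ∧ 0 ≤ g 0 x) ∧ 0 ≤ g 1 x) at this
    rcases this with h | ⟨h | ⟨h, -⟩, h'⟩
    · exact ⟨h.ge, Or.inl h⟩
    · exact ⟨h', Or.inr h⟩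
    · exact h.elim
  obtain ⟨β, γ, hne, hz⟩ := exists_comb_of_octahedron (gc := g 1 0) (kc := g 0 0)
    (gq := fun i => (g 1).linear (Pi.single i 1)) (kq := fun i => (g 0).linear (Pi.single i 1))
    (fun i => by
      have := hg' _ ⟨(i, true), rfl⟩
      simp only [if_true] at this
      rw [affineMap_eq (g 1), affineMap_eq (g 0)] at this
      simpa only [add_comm] using this)
    (fun i => by
      have := hg' _ ⟨(i, false), rfl⟩
      simp only [Bool.false_eq_true, if_false] at this
      rw [affineMap_eq (g 1), affineMap_eq (g 0), map_neg, map_neg] at this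
      simpa only [neg_add_eq_sub] using this)
  refine hne ?_
  have := Fintype.linearIndependent_iff.1 hli ![γ, β] (by
    refine LinearMap.pi_ext' fun i => LinearMap.ext_ring ?_
    have := hz i
    simp [Fin.sum_univ_two]
    linarith)
  exact ⟨this 1, this 0⟩

/-! ### Twelve points: the upper bound in dimension 4 -/

/-- The remaining conditions on the values of the second and third functional at a point that the
first functional has not removed. -/
def PeelValues (g k : ℝ) : Prop := 0 ≤ g ∧ (g = 0 ∨ k = 0)

theorem exists_comb_of_three_pairs {gc kc a1 a2 a3 b1 b2 b3 : ℝ}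
    (h1 : PeelValues (gc + a1) (kc + b1)) (h1' : PeelValues (gc - a1) (kc - b1))
    (h2 : PeelValues (gc + a2) (kc + b2)) (h2' : PeelValues (gc - a2) (kc - b2))
    (h3 : PeelValues (gc + a3) (kc + b3)) (h3' : PeelValues (gc - a3) (kc - b3)) :
    ∃ β γ : ℝ, ¬ (β = 0 ∧ γ = 0) ∧ β * a1 + γ * b1 = 0 ∧ β * a2 + γ * b2 = 0 ∧
      β * a3 + γ * b3 = 0 := by
  obtain ⟨β, γ, hne, hz⟩ := exists_comb_of_octahedron (gc := gc) (kc := kc)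
    (gq := ![a1, a2, a3]) (kq := ![b1, b2, b3])
    (by intro i; fin_cases i; exacts [h1, h2, h3])
    (by intro i; fin_cases i; exacts [h1', h2', h3'])
  exact ⟨β, γ, hne, hz 0, hz 1, hz 2⟩

section TwelvePoints

variable {g0 g1 g2 g3 g4 k0 k1 k2 k3 k4 v1 v2 v3 v4 : ℝ}

/-- These six of the twelve points form an octahedron with centre (1, 0, 0, 0) in the hyperplane x₁
= 1. The resulting combination of `g` and `k` is a nonzero multiple of x₁ and kills `v`. -/
theorem coord_eq_zero_of_octahedron
    (hind : ∀ β γ, β * g1 + γ * k1 = 0 → β * g2 + γ * k2 = 0 → β * g3 + γ * k3 = 0 →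
      β * g4 + γ * k4 = 0 → β = 0 ∧ γ = 0)
    (hgv : g1 * v1 + g2 * v2 + g3 * v3 + g4 * v4 = 0)
    (hkv : k1 * v1 + k2 * v2 + k3 * v3 + k4 * v4 = 0)
    (h1 : PeelValues (g0 + g1 + g2 + g3 + g4) (k0 + k1 + k2 + k3 + k4))
    (h2 : PeelValues (g0 + g1 + g2 + g3 - g4) (k0 + k1 + k2 + k3 - k4))
    (h3 : PeelValues (g0 + g1 - g2 - g3 + g4) (k0 + k1 - k2 - k3 + k4))
    (h4 : PeelValues (g0 + g1 - g2 - g3 - g4) (k0 + k1 - k2 - k3 - k4))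
    (h5 : PeelValues (g0 + g1 - g2 + g3) (k0 + k1 - k2 + k3))
    (h6 : PeelValues (g0 + g1 + g2 - g3) (k0 + k1 + k2 - k3)) : v1 = 0 := by
  obtain ⟨β, γ, hne, z1, z2, z3⟩ := exists_comb_of_three_pairs (gc := g0 + g1) (kc := k0 + k1)
    (a1 := g2 + g3 + g4) (a2 := g2 + g3 - g4) (a3 := g2 - g3)
    (b1 := k2 + k3 + k4) (b2 := k2 + k3 - k4) (b3 := k2 - k3)
    (by convert h1 using 1 <;> ring) (by convert h4 using 1 <;> ring)
    (by convert h2 using 1 <;> ring) (by convert h3 using 1 <;> ring)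
    (by convert h6 using 1 <;> ring) (by convert h5 using 1 <;> ring)
  have e2 : β * g2 + γ * k2 = 0 := by linarith
  have e3 : β * g3 + γ * k3 = 0 := by linarith
  have e4 : β * g4 + γ * k4 = 0 := by linarith
  have e1 : β * g1 + γ * k1 ≠ 0 := fun e1 => hne (hind β γ e1 e2 e3 e4)
  have : (β * g1 + γ * k1) * v1 = 0 := by
    linear_combination β * hgv + γ * hkv - v2 * e2 - v3 * e3 - v4 * e4
  exact (mul_eq_zero.1 this).resolve_left e1

/-- These six points form an octahedron with centre (0, 0, 0, 1/2) in the hyperplane x₁ + x₂ + x₃ +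
2x₄ = 1, so the combination found is proportional to that form. -/
theorem sum_eq_zero_of_octahedron
    (hind : ∀ β γ, β * g1 + γ * k1 = 0 → β * g2 + γ * k2 = 0 → β * g3 + γ * k3 = 0 →
      β * g4 + γ * k4 = 0 → β = 0 ∧ γ = 0)
    (hgv : g1 * v1 + g2 * v2 + g3 * v3 + g4 * v4 = 0)
    (hkv : k1 * v1 + k2 * v2 + k3 * v3 + k4 * v4 = 0)
    (h1 : PeelValues (g0 + g1 - g2 - g3 + g4) (k0 + k1 - k2 - k3 + k4))
    (h2 : PeelValues (g0 - g1 + g2 - g3 + g4) (k0 - k1 + k2 - k3 + k4))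
    (h3 : PeelValues (g0 - g1 - g2 + g3 + g4) (k0 - k1 - k2 + k3 + k4))
    (h4 : PeelValues (g0 - g1 + g2 + g3) (k0 - k1 + k2 + k3))
    (h5 : PeelValues (g0 + g1 - g2 + g3) (k0 + k1 - k2 + k3))
    (h6 : PeelValues (g0 + g1 + g2 - g3) (k0 + k1 + k2 - k3)) :
    v1 + v2 + v3 + 2 * v4 = 0 := by
  obtain ⟨β, γ, hne, z1, z2, z3⟩ := exists_comb_of_three_pairs
    (gc := g0 + g4 / 2) (kc := k0 + k4 / 2)
    (a1 := g1 - g2 - g3 + g4 / 2) (a2 := -g1 + g2 - g3 + g4 / 2) (a3 := -g1 - g2 + g3 + g4 / 2)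
    (b1 := k1 - k2 - k3 + k4 / 2) (b2 := -k1 + k2 - k3 + k4 / 2) (b3 := -k1 - k2 + k3 + k4 / 2)
    (by convert h1 using 1 <;> ring) (by convert h4 using 1 <;> ring)
    (by convert h2 using 1 <;> ring) (by convert h5 using 1 <;> ring)
    (by convert h3 using 1 <;> ring) (by convert h6 using 1 <;> ring)
  have e2 : β * g2 + γ * k2 = β * g1 + γ * k1 := by linarith
  have e3 : β * g3 + γ * k3 = β * g1 + γ * k1 := by linarith
  have e4 : β * g4 + γ * k4 = 2 * (β * g1 + γ * k1) := by linarith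
  have e1 : β * g1 + γ * k1 ≠ 0 := fun e1 =>
    hne (hind β γ e1 (e2.trans e1) (e3.trans e1) (by rw [e4, e1, mul_zero]))
  have : (β * g1 + γ * k1) * (v1 + v2 + v3 + 2 * v4) = 0 := by
    linear_combination β * hgv + γ * hkv - v2 * e2 - v3 * e3 - v4 * e4
  exact (mul_eq_zero.1 this).resolve_left e1

/-- `x, y, z` are signs with product `1`. -/
def SignTriple (x y z : ℝ) : Prop := x * x = 1 ∧ y * y = 1 ∧ z * z = 1 ∧ x * y * z = 1

variable {d a b c t : ℝ}

/-- Coordinate form of a peeling of the twelve points `(p, ±1)`, `(-p, 0)`, where `p` runs over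
the sign triples, by functionals with coefficients `(d; a, b, c, t)`, `(g0; g1, …, g4)` and
`(k0; k1, …, k4)`; the linear parts of the last two are independent and vanish at `v`. -/
structure TwelvePeeling (d a b c t g0 g1 g2 g3 g4 k0 k1 k2 k3 k4 v1 v2 v3 v4 : ℝ) : Prop where
  upper : ∀ x y z w, SignTriple x y z → w * w = 1 → 0 ≤ d + a * x + b * y + c * z + t * w ∧
    (0 < d + a * x + b * y + c * z + t * w →
      PeelValues (g0 + g1 * x + g2 * y + g3 * z + g4 * w) (k0 + k1 * x + k2 * y + k3 * z + k4 * w))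
  lower : ∀ x y z, SignTriple x y z → 0 ≤ d - a * x - b * y - c * z ∧
    (0 < d - a * x - b * y - c * z →
      PeelValues (g0 - g1 * x - g2 * y - g3 * z) (k0 - k1 * x - k2 * y - k3 * z))
  indep : ∀ β γ, β * g1 + γ * k1 = 0 → β * g2 + γ * k2 = 0 → β * g3 + γ * k3 = 0 →
      β * g4 + γ * k4 = 0 → β = 0 ∧ γ = 0
  ker_g : g1 * v1 + g2 * v2 + g3 * v3 + g4 * v4 = 0
  ker_k : k1 * v1 + k2 * v2 + k3 * v3 + k4 * v4 = 0

namespace TwelvePeeling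

/-- With `flip` and `reflect`, a symmetry of the twelve points, used to reduce the case analysis to
one representative octahedron of each kind. -/
theorem rot (P : TwelvePeeling d a b c t g0 g1 g2 g3 g4 k0 k1 k2 k3 k4 v1 v2 v3 v4) :
    TwelvePeeling d b c a t g0 g2 g3 g1 g4 k0 k2 k3 k1 k4 v2 v3 v1 v4 where
  upper x y z w h hw := by
    convert P.upper z x y w ⟨h.2.2.1, h.1, h.2.1, by linarith [h.2.2.2]⟩ hw using 2
    · ring
    · ring_nf
    · congr! 1 <;> ring
  lower x y z h := by
    convert P.lower z x y ⟨h.2.2.1, h.1, h.2.1, by linarith [h.2.2.2]⟩ using 2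
    · ring
    · ring_nf
    · congr! 1 <;> ring
  indep β γ e1 e2 e3 e4 := P.indep β γ e3 e1 e2 e4
  ker_g := by linarith [P.ker_g]
  ker_k := by linarith [P.ker_k]

theorem flip (P : TwelvePeeling d a b c t g0 g1 g2 g3 g4 k0 k1 k2 k3 k4 v1 v2 v3 v4) :
    TwelvePeeling d a (-b) (-c) t g0 g1 (-g2) (-g3) g4 k0 k1 (-k2) (-k3) k4
      v1 (-v2) (-v3) v4 where
  upper x y z w h hw := by
    convert P.upper x (-y) (-z) w ⟨h.1, by linarith [h.2.1], by linarith [h.2.2.1],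
      by linarith [h.2.2.2]⟩ hw using 2
    · ring
    · ring_nf
    · congr! 1 <;> ring
  lower x y z h := by
    convert P.lower x (-y) (-z) ⟨h.1, by linarith [h.2.1], by linarith [h.2.2.1],
      by linarith [h.2.2.2]⟩ using 2
    · ring
    · ring_nf
    · congr! 1 <;> ring
  indep β γ e1 e2 e3 e4 := P.indep β γ e1 (by linarith) (by linarith) e4
  ker_g := by linarith [P.ker_g]
  ker_k := by linarith [P.ker_k]

theorem reflect (P : TwelvePeeling d a b c t g0 g1 g2 g3 g4 k0 k1 k2 k3 k4 v1 v2 v3 v4) :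
    TwelvePeeling d a b c (-t) g0 g1 g2 g3 (-g4) k0 k1 k2 k3 (-k4) v1 v2 v3 (-v4) where
  upper x y z w h hw := by
    convert P.upper x y z (-w) h (by linarith) using 2
    · ring
    · ring_nf
    · congr! 1 <;> ring
  lower := P.lower
  indep β γ e1 e2 e3 e4 := P.indep β γ e1 e2 e3 (by linarith)
  ker_g := by linarith [P.ker_g]
  ker_k := by linarith [P.ker_k]

theorem nonneg (P : TwelvePeeling d a b c t g0 g1 g2 g3 g4 k0 k1 k2 k3 k4 v1 v2 v3 v4) :
    (0 ≤ d + a + b + c + t ∧ 0 ≤ d + a - b - c + t ∧ 0 ≤ d - a + b - c + t ∧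
      0 ≤ d - a - b + c + t) ∧
    (0 ≤ d + a + b + c - t ∧ 0 ≤ d + a - b - c - t ∧ 0 ≤ d - a + b - c - t ∧
      0 ≤ d - a - b + c - t) ∧
    (0 ≤ d - a - b - c ∧ 0 ≤ d - a + b + c ∧ 0 ≤ d + a - b + c ∧ 0 ≤ d + a + b - c) := by
  have s1 : SignTriple 1 1 1 := by norm_num [SignTriple]
  have s2 : SignTriple 1 (-1) (-1) := by norm_num [SignTriple]
  have s3 : SignTriple (-1) 1 (-1) := by norm_num [SignTriple]
  have s4 : SignTriple (-1) (-1) 1 := by norm_num [SignTriple]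
  refine ⟨⟨?_, ?_, ?_, ?_⟩, ⟨?_, ?_, ?_, ?_⟩, ?_, ?_, ?_, ?_⟩
  · linarith [(P.upper _ _ _ 1 s1 (by norm_num)).1]
  · linarith [(P.upper _ _ _ 1 s2 (by norm_num)).1]
  · linarith [(P.upper _ _ _ 1 s3 (by norm_num)).1]
  · linarith [(P.upper _ _ _ 1 s4 (by norm_num)).1]
  · linarith [(P.upper _ _ _ (-1) s1 (by norm_num)).1]
  · linarith [(P.upper _ _ _ (-1) s2 (by norm_num)).1]
  · linarith [(P.upper _ _ _ (-1) s3 (by norm_num)).1]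
  · linarith [(P.upper _ _ _ (-1) s4 (by norm_num)).1]
  · linarith [(P.lower _ _ _ s1).1]
  · linarith [(P.lower _ _ _ s2).1]
  · linarith [(P.lower _ _ _ s3).1]
  · linarith [(P.lower _ _ _ s4).1]

theorem coord_eq_zero (P : TwelvePeeling d a b c t g0 g1 g2 g3 g4 k0 k1 k2 k3 k4 v1 v2 v3 v4)
    (h1 : 0 < d + a + b + c + t) (h2 : 0 < d + a + b + c - t)
    (h3 : 0 < d + a - b - c + t) (h4 : 0 < d + a - b - c - t)
    (h5 : 0 < d + a - b + c) (h6 : 0 < d + a + b - c) : v1 = 0 := by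
  have s1 : SignTriple 1 1 1 := by norm_num [SignTriple]
  have s2 : SignTriple 1 (-1) (-1) := by norm_num [SignTriple]
  have s3 : SignTriple (-1) 1 (-1) := by norm_num [SignTriple]
  have s4 : SignTriple (-1) (-1) 1 := by norm_num [SignTriple]
  refine coord_eq_zero_of_octahedron (g0 := g0) (k0 := k0) P.indep P.ker_g P.ker_k
    ?_ ?_ ?_ ?_ ?_ ?_
  · convert (P.upper _ _ _ 1 s1 (by norm_num)).2 (by linarith) using 1 <;> ring
  · convert (P.upper _ _ _ (-1) s1 (by norm_num)).2 (by linarith) using 1 <;> ring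
  · convert (P.upper _ _ _ 1 s2 (by norm_num)).2 (by linarith) using 1 <;> ring
  · convert (P.upper _ _ _ (-1) s2 (by norm_num)).2 (by linarith) using 1 <;> ring
  · convert (P.lower _ _ _ s3).2 (by linarith) using 1 <;> ring
  · convert (P.lower _ _ _ s4).2 (by linarith) using 1 <;> ring

theorem sum_eq_zero (P : TwelvePeeling d a b c t g0 g1 g2 g3 g4 k0 k1 k2 k3 k4 v1 v2 v3 v4)
    (ht : 0 < t) (h2 : 0 < d - a + b + c) (h3 : 0 < d + a - b + c) (h4 : 0 < d + a + b - c) :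
    v1 + v2 + v3 + 2 * v4 = 0 := by
  have s2 : SignTriple 1 (-1) (-1) := by norm_num [SignTriple]
  have s3 : SignTriple (-1) 1 (-1) := by norm_num [SignTriple]
  have s4 : SignTriple (-1) (-1) 1 := by norm_num [SignTriple]
  obtain ⟨-, ⟨-, n2, n3, n4⟩, -⟩ := P.nonneg
  refine sum_eq_zero_of_octahedron (g0 := g0) (k0 := k0) P.indep P.ker_g P.ker_k
    ?_ ?_ ?_ ?_ ?_ ?_
  · convert (P.upper _ _ _ 1 s2 (by norm_num)).2 (by linarith) using 1 <;> ring
  · convert (P.upper _ _ _ 1 s3 (by norm_num)).2 (by linarith) using 1 <;> ring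
  · convert (P.upper _ _ _ 1 s4 (by norm_num)).2 (by linarith) using 1 <;> ring
  · convert (P.lower _ _ _ s2).2 (by linarith) using 1 <;> ring
  · convert (P.lower _ _ _ s3).2 (by linarith) using 1 <;> ring
  · convert (P.lower _ _ _ s4).2 (by linarith) using 1 <;> ring

theorem mul_coord_eq_zero
    (P : TwelvePeeling d a b c 0 g0 g1 g2 g3 g4 k0 k1 k2 k3 k4 v1 v2 v3 v4) : a * v1 = 0 := by
  rcases lt_trichotomy a 0 with h | rfl | h
  -- This composite changes the signs of the first and third coordinates, turning `a` into `-a`.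
  · have Q := P.rot.flip.rot.rot
    obtain ⟨-, ⟨n1, n2, n3, n4⟩, m1, m2, m3, m4⟩ := Q.nonneg
    have := Q.coord_eq_zero (by linarith) (by linarith) (by linarith) (by linarith)
      (by linarith) (by linarith)
    rw [neg_eq_zero.1 this, mul_zero]
  · exact zero_mul _
  · obtain ⟨-, ⟨n1, n2, n3, n4⟩, m1, m2, m3, m4⟩ := P.nonneg
    rw [P.coord_eq_zero (by linarith) (by linarith) (by linarith) (by linarith)
      (by linarith) (by linarith), mul_zero]

/-- The hypothesis `h` puts (-1, -1, -1, 0) on the first hyperplane. The value at (1, -1, -1, -1) is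
then `2 * a - t`; if it is positive, the whole octahedron in x₁ = 1 survives the first peel. -/
theorem sub_mul_coord_eq_zero
    (P : TwelvePeeling d a b c t g0 g1 g2 g3 g4 k0 k1 k2 k3 k4 v1 v2 v3 v4) (ht : 0 < t)
    (h : d = a + b + c) : (2 * a - t) * v1 = 0 := by
  obtain ⟨-, ⟨n1, n2, n3, n4⟩, m1, m2, m3, m4⟩ := P.nonneg
  rcases n2.eq_or_lt with h0 | h0
  · rw [show 2 * a - t = 0 by linarith, zero_mul]
  · rw [P.coord_eq_zero (by linarith) (by linarith) (by linarith) (by linarith)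
      (by linarith) (by linarith), mul_zero]

theorem apply_eq_zero_of_lower_eq
    (P : TwelvePeeling d a b c t g0 g1 g2 g3 g4 k0 k1 k2 k3 k4 v1 v2 v3 v4) (ht : 0 < t)
    (h : d = a + b + c) : a * v1 + b * v2 + c * v3 + t * v4 = 0 := by
  have e1 := P.sub_mul_coord_eq_zero ht h
  have e2 := P.rot.sub_mul_coord_eq_zero ht (by linarith)
  have e3 := P.rot.rot.sub_mul_coord_eq_zero ht (by linarith)
  obtain ⟨-, ⟨n1, n2, n3, n4⟩, m1, m2, m3, m4⟩ := P.nonneg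
  have e4 := P.sum_eq_zero ht (by linarith) (by linarith) (by linarith)
  linear_combination e1 / 2 + e2 / 2 + e3 / 2 + t / 2 * e4

/-- Either one of the four points with last coordinate 0 is peeled first, and a symmetry moves it to
(-1, -1, -1, 0), or all four survive and four octahedra give independent equations that force `v =
0`. -/
theorem apply_eq_zero_of_pos
    (P : TwelvePeeling d a b c t g0 g1 g2 g3 g4 k0 k1 k2 k3 k4 v1 v2 v3 v4) (ht : 0 < t) :
    a * v1 + b * v2 + c * v3 + t * v4 = 0 := by
  obtain ⟨-, -, m1, m2, m3, m4⟩ := P.nonneg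
  rcases m1.eq_or_lt with h1 | h1
  · exact P.apply_eq_zero_of_lower_eq ht (by linarith)
  rcases m2.eq_or_lt with h2 | h2
  · linarith [P.flip.apply_eq_zero_of_lower_eq ht (by linarith)]
  rcases m3.eq_or_lt with h3 | h3
  · linarith [P.rot.flip.apply_eq_zero_of_lower_eq ht (by linarith)]
  rcases m4.eq_or_lt with h4 | h4
  · linarith [P.rot.rot.flip.apply_eq_zero_of_lower_eq ht (by linarith)]
  have e1 := P.sum_eq_zero ht h2 h3 h4
  have e2 := P.flip.sum_eq_zero ht (by linarith) (by linarith) (by linarith)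
  have e3 := P.rot.flip.sum_eq_zero ht (by linarith) (by linarith) (by linarith)
  have e4 := P.rot.rot.flip.sum_eq_zero ht (by linarith) (by linarith) (by linarith)
  have z4 : v4 = 0 := by linarith
  have z1 : v1 = 0 := by linarith
  have z2 : v2 = 0 := by linarith
  have z3 : v3 = 0 := by linarith
  simp [z1, z2, z3, z4]

theorem apply_eq_zero
    (P : TwelvePeeling d a b c t g0 g1 g2 g3 g4 k0 k1 k2 k3 k4 v1 v2 v3 v4) :
    a * v1 + b * v2 + c * v3 + t * v4 = 0 := by
  rcases lt_trichotomy t 0 with h | rfl | h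
  · linarith [P.reflect.apply_eq_zero_of_pos (by linarith)]
  · linarith [P.mul_coord_eq_zero, P.rot.mul_coord_eq_zero, P.rot.rot.mul_coord_eq_zero]
  · exact P.apply_eq_zero_of_pos h

end TwelvePeeling

end TwelvePoints

/-- The twelve points `(p, 1)`, `(p, -1)`, `(-p, 0)` with `p` a vertex of the regular tetrahedron
formed by the sign triples. -/
def twelvePoints (i : (Bool × Bool) × Fin 3) : Fin 4 → ℝ :=
  let x : ℝ := if i.1.1 then 1 else -1
  let y : ℝ := if i.1.2 then 1 else -1
  ![![x, y, x * y, 1], ![x, y, x * y, -1], ![-x, -y, -(x * y), 0]] i.2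

theorem SignTriple.exists_bool {x y z : ℝ} (h : SignTriple x y z) :
    ∃ i j : Bool, x = (if i then 1 else -1) ∧ y = (if j then 1 else -1) ∧ z = x * y := by
  obtain ⟨h1, h2, h3, h4⟩ := h
  have hz : z = x * y := by linear_combination (-z * h1) - x * x * z * h2 + x * y * h4
  rcases mul_self_eq_one_iff.1 h1 with rfl | rfl <;> rcases mul_self_eq_one_iff.1 h2 with rfl | rfl
  · exact ⟨true, true, by simp, by simp, hz⟩
  · exact ⟨true, false, by simp, by simp, hz⟩
  · exact ⟨false, true, by simp, by simp, hz⟩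
  · exact ⟨false, false, by simp, by simp, hz⟩

theorem SignTriple.upper_mem {x y z w : ℝ} (h : SignTriple x y z) (hw : w * w = 1) :
    ![x, y, z, w] ∈ Set.range twelvePoints := by
  obtain ⟨i, j, hx, hy, rfl⟩ := h.exists_bool
  rcases mul_self_eq_one_iff.1 hw with rfl | rfl
  · exact ⟨((i, j), 0), by simp [twelvePoints, ← hx, ← hy]⟩
  · exact ⟨((i, j), 1), by simp [twelvePoints, ← hx, ← hy]⟩

theorem SignTriple.lower_mem {x y z : ℝ} (h : SignTriple x y z) :
    ![-x, -y, -z, 0] ∈ Set.range twelvePoints := by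
  obtain ⟨i, j, hx, hy, rfl⟩ := h.exists_bool
  exact ⟨((i, j), 2), by simp [twelvePoints, ← hx, ← hy]⟩

theorem mem_TSet_three {x : Fin 3 → ℝ} (h : x ∈ TSet 3) :
    0 ≤ x 2 ∧ (0 < x 2 → PeelValues (x 1) (x 0)) := by
  simp only [mem_TSet_succ] at h
  change (x 2 = 0 ∨ (x 1 = 0 ∨ (x 0 = 0 ∨ _ ∈ TSet 0 ∧ 0 ≤ x 0) ∧ 0 ≤ x 1) ∧ 0 ≤ x 2) at h
  rcases h with h | ⟨h | ⟨h | ⟨h, -⟩, h'⟩, h''⟩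
  · exact ⟨h.ge, fun h0 => absurd h h0.ne'⟩
  · exact ⟨h'', fun _ => ⟨h.ge, Or.inl h⟩⟩
  · exact ⟨h'', fun _ => ⟨h', Or.inr h⟩⟩
  · exact h.elim

/-- Supplies the vector on which `TwelvePeeling.apply_eq_zero` contradicts independence of the three
linear parts. -/
theorem exists_ker_of_linearIndependent {V : Type*} [AddCommGroup V] [Module ℝ V]
    {f : Fin 3 → V →ₗ[ℝ] ℝ} (hf : LinearIndependent ℝ f) :
    ∃ v, f 0 v = 0 ∧ f 1 v = 0 ∧ f 2 v ≠ 0 := by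
  by_contra! h
  have := mem_span_of_iInf_ker_le_ker (L := ![f 0, f 1]) (K := f 2) (by
    intro v hv
    simp only [Submodule.mem_iInf, LinearMap.mem_ker] at hv
    exact h v (hv 0) (hv 1))
  rw [Matrix.range_cons, Matrix.range_cons, Matrix.range_empty, Set.union_empty,
    Set.singleton_union, Submodule.mem_span_pair] at this
  obtain ⟨p, q, hpq⟩ := this
  have := Fintype.linearIndependent_iff.1 hf ![p, q, -1] (by
    simp [Fin.sum_univ_three, hpq]) 2
  simp at this

theorem tNumber_four_le : tNumber 4 ≤ 12 := by
  have key := tNumber_le_of_family twelvePoints ?_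
  · simpa using key
  intro hT
  obtain ⟨g, hli, hg⟩ := isTShaped_iff.1 hT
  obtain ⟨v, hv0, hv1, hv2⟩ := exists_ker_of_linearIndependent hli
  have hval : ∀ (i : Fin 3) (x y z w : ℝ), g i ![x, y, z, w] = g i 0 +
      (g i).linear (Pi.single 0 1) * x + (g i).linear (Pi.single 1 1) * y +
      (g i).linear (Pi.single 2 1) * z + (g i).linear (Pi.single 3 1) * w := by
    intro i x y z w
    rw [affineMap_eq_sum, Fin.sum_univ_four]
    simp
    ring
  have hlin : ∀ i : Fin 3, (g i).linear v = (g i).linear (Pi.single 0 1) * v 0 +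
      (g i).linear (Pi.single 1 1) * v 1 + (g i).linear (Pi.single 2 1) * v 2 +
      (g i).linear (Pi.single 3 1) * v 3 := by
    intro i
    have h1 := affineMap_eq (g i) v
    rw [affineMap_eq_sum, Fin.sum_univ_four] at h1
    linarith
  have hP : ∀ x ∈ Set.range twelvePoints, 0 ≤ g 2 x ∧ (0 < g 2 x → PeelValues (g 1 x) (g 0 x)) :=
    fun x hx => mem_TSet_three (hg x hx)
  have P : TwelvePeeling (g 2 0) _ _ _ _ (g 1 0) _ _ _ _ (g 0 0) _ _ _ _ _ _ _ _ :=
    { upper := fun x y z w h hw => by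
        have := hP _ (h.upper_mem hw)
        rwa [hval, hval, hval] at this
      lower := fun x y z h => by
        have := hP _ h.lower_mem
        rw [hval, hval, hval] at this
        simpa only [mul_neg, mul_zero, add_zero, ← sub_eq_add_neg] using this
      indep := fun β γ e1 e2 e3 e4 => by
        have := Fintype.linearIndependent_iff.1 hli ![γ, β, 0] (by
          refine LinearMap.pi_ext' fun i => LinearMap.ext_ring ?_
          simp [Fin.sum_univ_three]
          fin_cases i
          · simpa [add_comm] using e1
          · simpa [add_comm] using e2
          · simpa [add_comm] using e3
          · simpa [add_comm] using e4)
        exact ⟨this 1, this 0⟩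
      ker_g := (hlin 1).symm.trans hv1
      ker_k := (hlin 0).symm.trans hv0 }
  exact hv2 ((hlin 2).trans P.apply_eq_zero)

/-! ### Facets of finite point sets -/

open Classical in
/-- Tilting `φ` by a nonnegative functional `σ` until it supports `R` at a new point. -/
theorem exists_tilt {V : Type*} {R : Finset V} {σ φ : V → ℝ} (hσ : ∀ c ∈ R, 0 ≤ σ c)
    (hpos : ∃ c ∈ R, 0 < σ c) (hφ : ∀ c ∈ R, σ c = 0 → 0 ≤ φ c) :
    ∃ t : ℝ, (∃ r ∈ R, 0 < σ r ∧ φ r + t * σ r = 0) ∧ ∀ c ∈ R, 0 ≤ φ c + t * σ c := by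
  obtain ⟨c₀, hc₀, hc₀'⟩ := hpos
  obtain ⟨r, hr, hmax⟩ := Finset.exists_max_image (R.filter (0 < σ ·)) (fun c => -φ c / σ c)
    ⟨c₀, Finset.mem_filter.2 ⟨hc₀, hc₀'⟩⟩
  rw [Finset.mem_filter] at hr
  refine ⟨-φ r / σ r, ⟨r, hr.1, hr.2, ?_⟩, fun c hc => ?_⟩
  · rw [div_mul_cancel₀ _ hr.2.ne']; ring
  · rcases (hσ c hc).eq_or_lt with h | h
    · rw [← h, mul_zero, add_zero]; exact hφ c hc h.symm
    · have := hmax c (Finset.mem_filter.2 ⟨hc, h⟩)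
      rw [div_le_iff₀ h] at this
      linarith

section Facets

variable {V : Type*} [AddCommGroup V] [Module ℝ V]

/-- `g` supports `R`. -/
def Supports (g : V →ᵃ[ℝ] ℝ) (R : Finset V) : Prop := g.linear ≠ 0 ∧ ∀ c ∈ R, 0 ≤ g c

/-- `R` lies in no hyperplane. -/
def Spanning (R : Finset V) : Prop := ∀ g : V →ᵃ[ℝ] ℝ, (∀ c ∈ R, g c = 0) → g.linear = 0

theorem Spanning.exists_pos {R : Finset V} (hR : Spanning R) {g : V →ᵃ[ℝ] ℝ} (hg : Supports g R) :
    ∃ c ∈ R, 0 < g c := by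
  by_contra! h
  exact hg.1 (hR g fun c hc => le_antisymm (h c hc) (hg.2 c hc))

theorem affineMap_eq_zero {g : V →ᵃ[ℝ] ℝ} (hg : g.linear = 0) {x : V} (hx : g x = 0) : g = 0 := by
  ext y
  rw [affineMap_const hg y x, hx]
  rfl

/-- `g` supports `R` along a facet. -/
def IsFacet (g : V →ᵃ[ℝ] ℝ) (R : Finset V) : Prop :=
  Supports g R ∧ ∀ φ : V →ᵃ[ℝ] ℝ, (∀ c ∈ R, g c = 0 → φ c = 0) → ∃ t : ℝ, φ = t • g

/-- A supporting functional tilts to the functional of a facet. -/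
theorem exists_facet {R : Finset V} (hR : Spanning R) {g₀ : V →ᵃ[ℝ] ℝ} (hg₀ : Supports g₀ R) :
    ∃ g : V →ᵃ[ℝ] ℝ, IsFacet g R ∧ ∀ c ∈ R, g₀ c = 0 → g c = 0 := by
  classical
  let N : (V →ᵃ[ℝ] ℝ) → ℕ := fun g => (R.filter (g · = 0)).card
  -- Take the most zeros possible. A functional vanishing on these zeros without being a multiple of
  -- `g` could be tilted by `g` to a supporting functional with one more zero.
  obtain ⟨g, ⟨hg, hz⟩, hmax⟩ : ∃ g : V →ᵃ[ℝ] ℝ,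
      (Supports g R ∧ ∀ c ∈ R, g₀ c = 0 → g c = 0) ∧
      ∀ g' : V →ᵃ[ℝ] ℝ, (Supports g' R ∧ ∀ c ∈ R, g₀ c = 0 → g' c = 0) → N g' ≤ N g := by
    let S : Set ℕ := {k | ∃ g : V →ᵃ[ℝ] ℝ, (Supports g R ∧ ∀ c ∈ R, g₀ c = 0 → g c = 0) ∧ N g = k}
    have hb : BddAbove S := ⟨R.card, by
      rintro _ ⟨g, -, rfl⟩; exact Finset.card_filter_le _ _⟩
    obtain ⟨g, hg, hgS⟩ : sSup S ∈ S := Nat.sSup_mem ⟨_, g₀, ⟨hg₀, fun _ _ h => h⟩, rfl⟩ hb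
    exact ⟨g, hg, fun g' hg' => hgS ▸ le_csSup hb ⟨g', hg', rfl⟩⟩
  refine ⟨g, ⟨hg, fun φ hφ => ?_⟩, hz⟩
  obtain ⟨t, ⟨r, hr, hr', hr0⟩, hpos⟩ :=
    exists_tilt hg.2 (hR.exists_pos hg) (φ := φ) fun c hc h => (hφ c hc h).ge
  by_cases hlin : (φ + t • g).linear = 0
  · have := affineMap_eq_zero hlin (x := r) (by simpa using hr0)
    exact ⟨-t, by rw [neg_smul]; exact eq_neg_of_add_eq_zero_left this⟩
  · exfalso
    have := hmax (φ + t • g) ⟨⟨hlin, fun c hc => by simpa using hpos c hc⟩, fun c hc h => by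
      simp [hz c hc h, hφ c hc (hz c hc h)]⟩
    refine absurd this (not_le.2 (Finset.card_lt_card ?_))
    refine Finset.ssubset_iff_subset_ne.2 ⟨fun c hc => ?_, fun heq => ?_⟩
    · rw [Finset.mem_filter] at hc ⊢
      exact ⟨hc.1, by simp [hc.2, hφ c hc.1 hc.2]⟩
    · have : r ∈ R.filter (g · = 0) := heq ▸ Finset.mem_filter.2 ⟨hr, by simpa using hr0⟩
      exact hr'.ne' (Finset.mem_filter.1 this).2

theorem exists_supports [Nontrivial V] {R : Finset V} (hR : R.Nonempty) :
    ∃ g : V →ᵃ[ℝ] ℝ, Supports g R := by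
  obtain ⟨v, hv⟩ := exists_ne (0 : V)
  obtain ⟨f, hf⟩ : ∃ f : V →ₗ[ℝ] ℝ, f v ≠ 0 := by
    by_contra! h
    exact hv ((Module.forall_dual_apply_eq_zero_iff ℝ v).1 h)
  obtain ⟨r, -, hmin⟩ := R.exists_min_image f hR
  refine ⟨f.toAffineMap - AffineMap.const ℝ V (f r), ?_, fun c hc => ?_⟩
  · intro h
    refine hf ?_
    have := congrArg (fun φ : V →ₗ[ℝ] ℝ => φ v) h
    simpa using this
  · simpa using hmin c hc

/-- Evaluation of affine functionals on a finite set. -/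
def evalOn (Z : Finset V) : (V →ᵃ[ℝ] ℝ) →ₗ[ℝ] (Z → ℝ) where
  toFun g z := g z
  map_add' _ _ := rfl
  map_smul' _ _ := rfl

theorem finrank_range_evalOn_le (Z : Finset V) :
    finrank ℝ (LinearMap.range (evalOn Z)) ≤ Z.card :=
  (Submodule.finrank_le _).trans (by simp)

open Classical in
theorem IsFacet.finrank_ker_le {R : Finset V} {g : V →ᵃ[ℝ] ℝ} (hg : IsFacet g R) :
    finrank ℝ (LinearMap.ker (evalOn (R.filter (g · = 0)))) ≤ 1 := by
  have : LinearMap.ker (evalOn (R.filter (g · = 0))) ≤ Submodule.span ℝ {g} := by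
    intro φ hφ
    obtain ⟨t, rfl⟩ := hg.2 φ fun c hc h0 =>
      congrFun (LinearMap.mem_ker.1 hφ) ⟨c, Finset.mem_filter.2 ⟨hc, h0⟩⟩
    exact Submodule.smul_mem _ _ (Submodule.mem_span_singleton_self g)
  exact (Submodule.finrank_mono this).trans
    ((finrank_span_le_card _).trans (by simp))

variable [FiniteDimensional ℝ V]

theorem finrank_affineMap : finrank ℝ (V →ᵃ[ℝ] ℝ) = finrank ℝ V + 1 := by
  rw [(AffineMap.toConstProdLinearMap ℝ (k := ℝ) (V1 := V) (V2 := ℝ)).finrank_eq, finrank_prod,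
    finrank_self, add_comm]
  congr 1
  exact Subspace.dual_finrank_eq

instance finiteDimensional_affineMap : FiniteDimensional ℝ (V →ᵃ[ℝ] ℝ) :=
  (AffineMap.toConstProdLinearMap ℝ (k := ℝ) (V1 := V) (V2 := ℝ)).symm.finiteDimensional

theorem finrank_range_evalOn (Z : Finset V) :
    finrank ℝ (LinearMap.range (evalOn Z)) + finrank ℝ (LinearMap.ker (evalOn Z)) =
      finrank ℝ V + 1 := by
  rw [LinearMap.finrank_range_add_finrank_ker, finrank_affineMap]

open Classical in
theorem IsFacet.finrank_le_card {R : Finset V} {g : V →ᵃ[ℝ] ℝ} (hg : IsFacet g R) :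
    finrank ℝ V ≤ (R.filter (g · = 0)).card := by
  have h1 := finrank_range_evalOn (R.filter (g · = 0))
  have h2 := finrank_range_evalOn_le (R.filter (g · = 0))
  have h3 := hg.finrank_ker_le
  omega

open Classical in
-- By rank-nullity, affine functionals take arbitrary values on a facet with the minimal number of
-- points, so its points are the vertices of a simplex; `φ` is a barycentric coordinate.
theorem IsFacet.exists_dual {R : Finset V} {g : V →ᵃ[ℝ] ℝ} (hg : IsFacet g R)
    (hc : (R.filter (g · = 0)).card = finrank ℝ V) {f : V} (hf : f ∈ R) (hf0 : g f = 0) :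
    ∃ φ : V →ᵃ[ℝ] ℝ, φ f = 1 ∧ ∀ c ∈ R, g c = 0 → c ≠ f → φ c = 0 := by
  have h1 := finrank_range_evalOn (R.filter (g · = 0))
  have h2 := finrank_range_evalOn_le (R.filter (g · = 0))
  have h3 := hg.finrank_ker_le
  have hr : LinearMap.range (evalOn (R.filter (g · = 0))) = ⊤ :=
    Submodule.eq_top_of_finrank_eq (by simp only [finrank_fintype_fun_eq_card, Fintype.card_coe]; omega)
  obtain ⟨φ, hφ⟩ := LinearMap.range_eq_top.1 hr
    (Pi.single ⟨f, Finset.mem_filter.2 ⟨hf, hf0⟩⟩ (1 : ℝ))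
  refine ⟨φ, ?_, fun c hc h0 hne => ?_⟩
  · have := congrFun hφ ⟨f, Finset.mem_filter.2 ⟨hf, hf0⟩⟩
    rwa [Pi.single_eq_same] at this
  · have := congrFun hφ ⟨c, Finset.mem_filter.2 ⟨hc, h0⟩⟩
    rwa [Pi.single_eq_of_ne (by simpa [Subtype.ext_iff] using hne)] at this

end Facets

/-! ### Recursive lower bounds by counting points on and off a facet -/

theorem spanning_of_not_isTShaped {m : ℕ} {A : Finset (Fin (m + 2) → ℝ)}
    (hA : ¬ IsTShaped (A : Set (Fin (m + 2) → ℝ))) : Spanning A := by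
  intro g hg
  by_contra h
  exact hA (isTShaped_of_subset_hyperplane h hg)

theorem Spanning.nonempty {V : Type*} [AddCommGroup V] [Module ℝ V] [Nontrivial V] {R : Finset V}
    (hR : Spanning R) : R.Nonempty := by
  obtain ⟨g, hg⟩ := exists_supports (V := V) (Finset.singleton_nonempty 0)
  by_contra h
  rw [Finset.not_nonempty_iff_eq_empty] at h
  exact hg.1 (hR g (by simp [h]))

open Classical in
theorem card_pos_add_card_zero {V : Type*} [AddCommGroup V] [Module ℝ V] {R : Finset V}
    {g : V →ᵃ[ℝ] ℝ} (hg : ∀ c ∈ R, 0 ≤ g c) :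
    (R.filter (0 < g ·)).card + (R.filter (g · = 0)).card = R.card := by
  rw [← Finset.card_filter_add_card_filter_not (s := R) (0 < g ·)]
  congr 2
  refine Finset.filter_congr fun c hc => ?_
  rw [not_lt]
  exact ⟨fun h => h.le, fun h => le_antisymm h (hg c hc)⟩

open Classical in
theorem le_card_pos_of_not_isTShaped {m N : ℕ} (hN : (N : ℕ∞) ≤ tNumber (m + 1))
    {A : Finset (Fin (m + 2) → ℝ)} (hA : ¬ IsTShaped (A : Set (Fin (m + 2) → ℝ)))
    {g : (Fin (m + 2) → ℝ) →ᵃ[ℝ] ℝ} (hg : Supports g A) : N ≤ (A.filter (0 < g ·)).card := by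
  by_contra! h
  exact hA (isTShaped_of_card_lt hg.1 hg.2 (lt_of_lt_of_le (by exact_mod_cast h) hN))

open Classical in
/-- The sharper bound, available when removing the level set on top is also of use. -/
theorem lt_card_pos_of_not_isTShaped {m N : ℕ} (hN : (N : ℕ∞) ≤ tNumber (m + 1))
    {A : Finset (Fin (m + 2) → ℝ)} (hA : ¬ IsTShaped (A : Set (Fin (m + 2) → ℝ)))
    {g : (Fin (m + 2) → ℝ) →ᵃ[ℝ] ℝ} (hg : Supports g A) (hc : A.card < 2 * N) :
    N < (A.filter (0 < g ·)).card ∧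
      ∃ p ∈ A.filter (0 < g ·), ∃ q ∈ A.filter (0 < g ·), g p ≠ g q := by
  have hle := le_card_pos_of_not_isTShaped hN hA hg
  have hlev : ∃ p ∈ A.filter (0 < g ·), ∃ q ∈ A.filter (0 < g ·), g p ≠ g q := by
    by_contra! h
    obtain ⟨r, hr⟩ : (A.filter (0 < g ·)).Nonempty := Finset.card_pos.1 (by omega)
    -- If all points off the face share one level, `σ` supports `A` from the opposite side. Both
    -- levels then have at least `N` points, against `hc`.
    let σ : (Fin (m + 2) → ℝ) →ᵃ[ℝ] ℝ := AffineMap.const ℝ _ (g r) - g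
    have hσ : ∀ c, σ c = g r - g c := fun c => by simp [σ]
    have hr0 := (Finset.mem_filter.1 hr).2
    have key : ∀ c ∈ A, g c = 0 ∨ g c = g r := fun c hc => by
      rcases (hg.2 c hc).eq_or_lt with h0 | h0
      · exact Or.inl h0.symm
      · exact Or.inr (h c (Finset.mem_filter.2 ⟨hc, h0⟩) r hr)
    have hs : Supports σ A := by
      refine ⟨fun h0 => hg.1 ?_, fun c hc => ?_⟩
      · have : σ.linear = - g.linear := by simp [σ]
        rwa [this, neg_eq_zero] at h0
      · rw [hσ]
        rcases key c hc with h0 | h0 <;> rw [h0] <;> linarith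
    have h1 := le_card_pos_of_not_isTShaped hN hA hs
    have h2 := card_pos_add_card_zero hg.2
    have h3 : A.filter (0 < σ ·) = A.filter (g · = 0) := Finset.filter_congr fun c hc => by
      rw [hσ]
      rcases key c hc with h0 | h0 <;> rw [h0]
      · simpa using hr0
      · simp [hr0.ne']
    rw [h3] at h1
    omega
  refine ⟨lt_of_le_of_ne hle fun heq => ?_, hlev⟩
  obtain ⟨p, hp, q, hq, hpq⟩ := hlev
  exact hA (isTShaped_of_card_le hg.2 (heq ▸ hN) hp hq hpq)

theorem tNumber_add_le {m N : ℕ} (hN : (N : ℕ∞) ≤ tNumber (m + 1)) :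
    ((N + (m + 2) : ℕ) : ℕ∞) ≤ tNumber (m + 2) := by
  classical
  refine le_tNumber fun A hA => ?_
  have hsp := spanning_of_not_isTShaped hA
  obtain ⟨g₀, hg₀⟩ := exists_supports hsp.nonempty
  obtain ⟨g, hg, -⟩ := exists_facet hsp hg₀
  have h1 := le_card_pos_of_not_isTShaped hN hA hg.1
  have h2 := card_pos_add_card_zero hg.1.2
  have h3 := hg.finrank_le_card
  simp only [finrank_fintype_fun_eq_card, Fintype.card_fin] at h3
  omega

/-- A counterexample has at most `N + (m + 2)` points; `hm` makes this less than `2 * N`, so the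
sharper count applies. -/
theorem tNumber_add_succ_le {m N : ℕ} (hN : (N : ℕ∞) ≤ tNumber (m + 1)) (hm : m + 2 < N) :
    ((N + (m + 2) + 1 : ℕ) : ℕ∞) ≤ tNumber (m + 2) := by
  classical
  refine le_tNumber fun A hA => ?_
  by_contra! hlt
  have hsp := spanning_of_not_isTShaped hA
  obtain ⟨g₀, hg₀⟩ := exists_supports hsp.nonempty
  obtain ⟨g, hg, -⟩ := exists_facet hsp hg₀
  have h1 := (lt_card_pos_of_not_isTShaped hN hA hg.1 (by omega)).1
  have h2 := card_pos_add_card_zero hg.1.2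
  have h3 := hg.finrank_le_card
  simp only [finrank_fintype_fun_eq_card, Fintype.card_fin] at h3
  omega

theorem one_le_tNumber_one : ((1 : ℕ) : ℕ∞) ≤ tNumber 1 := by
  refine le_tNumber fun A hA => ?_
  rw [Nat.one_le_iff_ne_zero, Ne, Finset.card_eq_zero]
  rintro rfl
  exact hA ((isTShaped_iff (m := 0)).2 ⟨finZeroElim, linearIndependent_empty_type, by simp⟩)

theorem six_le_tNumber_three : ((6 : ℕ) : ℕ∞) ≤ tNumber 3 :=
  tNumber_add_le (m := 1) (N := 3) (tNumber_add_le (m := 0) (N := 1) one_le_tNumber_one)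

/-! ### Dimension 4: two successive faces of a set of at most eleven points -/

theorem isTShaped_of_peel {A : Set (Fin 4 → ℝ)} {h g k : (Fin 4 → ℝ) →ᵃ[ℝ] ℝ}
    (hli : LinearIndependent ℝ ![k.linear, g.linear, h.linear]) (hh : ∀ c ∈ A, 0 ≤ h c)
    (hg : ∀ c ∈ A, 0 < h c → 0 ≤ g c) (hk : ∀ c ∈ A, 0 < h c → 0 < g c → k c = 0) :
    IsTShaped A := by
  refine (isTShaped_iff (m := 3)).2 ⟨![k, g, h], ?_, fun c hc => ?_⟩
  · convert hli using 1
    funext i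
    fin_cases i <;> rfl
  · rw [mem_TSet_succ, mem_TSet_succ, mem_TSet_succ]
    change h c = 0 ∨ (g c = 0 ∨ (k c = 0 ∨ _ ∈ TSet 0 ∧ 0 ≤ k c) ∧ 0 ≤ g c) ∧ 0 ≤ h c
    rcases (hh c hc).eq_or_lt with h0 | h0
    · exact Or.inl h0.symm
    · refine Or.inr ⟨?_, h0.le⟩
      rcases (hg c hc h0).eq_or_lt with g0 | g0
      · exact Or.inl g0.symm
      · exact Or.inr ⟨Or.inl (hk c hc h0 g0), g0.le⟩

/-- The affine functionals vanishing on `X` have dimension at least `finrank V + 1 - |X|`. -/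
theorem le_finrank_ker_evalOn {V : Type*} [AddCommGroup V] [Module ℝ V] [FiniteDimensional ℝ V]
    (X : Finset V) : finrank ℝ V + 1 ≤ X.card + finrank ℝ (LinearMap.ker (evalOn X)) := by
  have := finrank_range_evalOn X
  have := finrank_range_evalOn_le X
  omega

/-- If the linear part of every functional vanishing on `X` is spanned by those of `g` and `h`,
then `X` has at least `finrank V - 1` points, with equality only when `g` and `h` are constant
on `X`. -/
theorem const_of_ker_evalOn_le {V : Type*} [AddCommGroup V] [Module ℝ V] [FiniteDimensional ℝ V]
    {X : Finset V} {g h : V →ᵃ[ℝ] ℝ} (hV : 3 ≤ finrank ℝ V)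
    (hX : ∀ k : V →ᵃ[ℝ] ℝ, (∀ x ∈ X, k x = 0) →
      k.linear ∈ Submodule.span ℝ (Set.range ![g.linear, h.linear])) :
    X.Nonempty ∧ finrank ℝ V ≤ X.card + 1 ∧
      (finrank ℝ V = X.card + 1 → ∀ x ∈ X, ∀ y ∈ X, g x = g y ∧ h x = h y) := by
  classical
  let e : V →ᵃ[ℝ] ℝ := AffineMap.const ℝ V 1
  let U : Submodule ℝ (V →ᵃ[ℝ] ℝ) := Submodule.span ℝ (({g, h, e} : Finset (V →ᵃ[ℝ] ℝ)) : Set _)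
  have hU : finrank ℝ U ≤ 3 := (finrank_span_finset_le_card _).trans Finset.card_le_three
  have hgU : g ∈ U := Submodule.subset_span (by simp)
  have hhU : h ∈ U := Submodule.subset_span (by simp)
  have heU : e ∈ U := Submodule.subset_span (by simp)
  have hle : LinearMap.ker (evalOn X) ≤ U := by
    intro k hk
    have hk' := hX k fun x hx => congrFun (LinearMap.mem_ker.1 hk) ⟨x, hx⟩
    rw [Matrix.range_cons, Matrix.range_cons, Matrix.range_empty, Set.union_empty,
      Set.singleton_union, Submodule.mem_span_pair] at hk'
    obtain ⟨a, b, hab⟩ := hk'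
    have : k = a • g + b • h + (k 0 - a * g 0 - b * h 0) • e := by
      ext x
      rw [affineMap_eq k, ← hab]
      simp [e, affineMap_eq g x, affineMap_eq h x]
      ring
    rw [this]
    exact U.add_mem (U.add_mem (U.smul_mem _ hgU) (U.smul_mem _ hhU)) (U.smul_mem _ heU)
  have hdim := le_finrank_ker_evalOn X
  have hne : X.Nonempty := by
    by_contra h0
    rw [Finset.not_nonempty_iff_eq_empty] at h0
    subst h0
    have := Submodule.finrank_mono hle
    simp only [Finset.card_empty] at hdim
    omega
  obtain ⟨x₀, hx₀⟩ := hne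
  have he : e ∉ LinearMap.ker (evalOn X) := fun h0 => by
    have := congrFun (LinearMap.mem_ker.1 h0) ⟨x₀, hx₀⟩
    exact one_ne_zero this
  -- The kernel lies in the span `U` of `g`, `h` and the constant 1 but misses the constants, so its
  -- dimension is at most 2. When it is exactly 2, kernel and constants fill `U`, and `g`, `h` are
  -- constant on `X`.
  have hlt : LinearMap.ker (evalOn X) < LinearMap.ker (evalOn X) ⊔ Submodule.span ℝ {e} := by
    refine lt_of_le_of_ne le_sup_left fun heq => he ?_
    rw [heq]
    exact Submodule.mem_sup_right (Submodule.mem_span_singleton_self e)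
  have hleU : LinearMap.ker (evalOn X) ⊔ Submodule.span ℝ {e} ≤ U :=
    sup_le hle ((Submodule.span_singleton_le_iff_mem _ _).2 heU)
  have h1 := Submodule.finrank_lt_finrank_of_lt hlt
  have h2 := Submodule.finrank_mono hleU
  refine ⟨⟨x₀, hx₀⟩, by omega, fun heq => ?_⟩
  have hUeq : LinearMap.ker (evalOn X) ⊔ Submodule.span ℝ {e} = U :=
    Submodule.eq_of_le_of_finrank_le hleU (by omega)
  have hconst : ∀ f ∈ U, ∀ x ∈ X, ∀ y ∈ X, f x = f y := by
    intro f hf x hx y hy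
    rw [← hUeq] at hf
    obtain ⟨k, hk, w, hw, rfl⟩ := Submodule.mem_sup.1 hf
    obtain ⟨c, rfl⟩ := Submodule.mem_span_singleton.1 hw
    have hkx : k x = 0 := congrFun (LinearMap.mem_ker.1 hk) ⟨x, hx⟩
    have hky : k y = 0 := congrFun (LinearMap.mem_ker.1 hk) ⟨y, hy⟩
    simp [hkx, hky, e]
  exact fun x hx y hy => ⟨hconst g hgU x hx y hy, hconst h hhU x hx y hy⟩

theorem linearIndependent_pair_of_apply {V : Type*} [AddCommGroup V] [Module ℝ V]
    {g h : V →ᵃ[ℝ] ℝ} (hg : g.linear ≠ 0) {x y : V} (hgxy : g x = g y) (hxy : h x ≠ h y) :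
    LinearIndependent ℝ ![g.linear, h.linear] := by
  rw [LinearIndependent.pair_iff]
  intro a b hab
  have h1 := congrArg (fun φ : V →ₗ[ℝ] ℝ => φ (x - y)) hab
  simp only [LinearMap.add_apply, LinearMap.smul_apply, ← affineMap_sub, LinearMap.zero_apply,
    smul_eq_mul, hgxy, sub_self, mul_zero, zero_add] at h1
  have hb : b = 0 := (mul_eq_zero.1 h1).resolve_right (sub_ne_zero.2 hxy)
  subst hb
  rw [zero_smul, add_zero] at hab
  exact ⟨(smul_eq_zero.1 hab).resolve_right hg, rfl⟩

theorem apply_eq_of_not_linearIndependent {V : Type*} [AddCommGroup V] [Module ℝ V]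
    {g h : V →ᵃ[ℝ] ℝ} (hg : g.linear ≠ 0) (hli : ¬ LinearIndependent ℝ ![g.linear, h.linear])
    {x y : V} (hgxy : g x = g y) : h x = h y := by
  by_contra hxy
  exact hli (linearIndependent_pair_of_apply hg hgxy hxy)

section FourSpace

open Classical

variable {A : Finset (Fin 4 → ℝ)} {h g : (Fin 4 → ℝ) →ᵃ[ℝ] ℝ}

theorem seven_le_card_pos (hA : ¬ IsTShaped (A : Set (Fin 4 → ℝ))) (hcard : A.card ≤ 11)
    (hh : Supports h A) : 7 ≤ (A.filter (0 < h ·)).card ∧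
      ∃ p ∈ A.filter (0 < h ·), ∃ q ∈ A.filter (0 < h ·), h p ≠ h q :=
  lt_card_pos_of_not_isTShaped (m := 2) six_le_tNumber_three hA hh (by omega)

/-- After removing two faces with at least four points, there are three points left, and both
functionals are constant on them. -/
theorem second_face (hA : ¬ IsTShaped (A : Set (Fin 4 → ℝ))) (hcard : A.card ≤ 11)
    (hh : Supports h A) (hh4 : 4 ≤ (A.filter (h · = 0)).card)
    (hli : LinearIndependent ℝ ![g.linear, h.linear])
    (hg : ∀ c ∈ A.filter (0 < h ·), 0 ≤ g c)
    (hg4 : 4 ≤ ((A.filter (0 < h ·)).filter (g · = 0)).card) :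
    ((A.filter (0 < h ·)).filter (g · = 0)).card = 4 ∧
    ((A.filter (0 < h ·)).filter (0 < g ·)).card = 3 ∧
    ∃ s u : ℝ, 0 < s ∧ 0 < u ∧ ∀ x ∈ (A.filter (0 < h ·)).filter (0 < g ·), h x = s ∧ g x = u := by
  have h1 := card_pos_add_card_zero hh.2
  have h2 := card_pos_add_card_zero hg
  obtain ⟨⟨x₀, hx₀⟩, h3, h4⟩ := const_of_ker_evalOn_le (V := Fin 4 → ℝ)
    (X := (A.filter (0 < h ·)).filter (0 < g ·)) (g := g) (h := h) (by simp) (by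
      intro k hk
      by_contra hspan
      refine hA (isTShaped_of_peel (k := k) (g := g) (h := h)
        (linearIndependent_finCons.2 ⟨hli, hspan⟩) hh.2 (fun c hc h0 => hg c ?_)
        fun c hc h0 g0 => hk c ?_)
      · exact Finset.mem_filter.2 ⟨hc, h0⟩
      · exact Finset.mem_filter.2 ⟨Finset.mem_filter.2 ⟨hc, h0⟩, g0⟩)
  simp only [finrank_fintype_fun_eq_card, Fintype.card_fin] at h3 h4
  have hx := Finset.mem_filter.1 hx₀
  refine ⟨by omega, by omega, h x₀, g x₀, (Finset.mem_filter.1 hx.1).2, hx.2, fun x hx => ?_⟩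
  exact (h4 (by omega) x hx x₀ hx₀).symm

/-- A hyperplane through all remaining points would be transversal to `h`, which takes two values on
them, so it would be a second face of at least seven points where `second_face` allows four. -/
theorem spanning_pos (hA : ¬ IsTShaped (A : Set (Fin 4 → ℝ))) (hcard : A.card ≤ 11)
    (hh : Supports h A) (hh4 : 4 ≤ (A.filter (h · = 0)).card) :
    Spanning (A.filter (0 < h ·)) := by
  intro k hk
  by_contra hlin
  obtain ⟨h7, p, hp, q, hq, hpq⟩ := seven_le_card_pos hA hcard hh
  have hli := linearIndependent_pair_of_apply (h := h) hlin ((hk p hp).trans (hk q hq).symm) hpq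
  have hz : (A.filter (0 < h ·)).filter (k · = 0) = A.filter (0 < h ·) :=
    Finset.filter_true_of_mem hk
  have := (second_face hA hcard hh hh4 hli (fun c hc => (hk c hc).ge) (by rw [hz]; omega)).1
  rw [hz] at this
  omega

/-- A spanning set has a facet whose hyperplane is transversal to a given one. -/
theorem exists_transversal_facet {V : Type*} [AddCommGroup V] [Module ℝ V]
    [FiniteDimensional ℝ V] (hV : 2 ≤ finrank ℝ V) {R : Finset V} (hR : Spanning R)
    {h : V →ᵃ[ℝ] ℝ} (hh : h.linear ≠ 0) :
    ∃ g, IsFacet g R ∧ ∃ x ∈ R, ∃ y ∈ R, g x = 0 ∧ g y = 0 ∧ h x ≠ h y := by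
  have : Nontrivial V := Module.nontrivial_of_finrank_pos (R := ℝ) (by omega)
  obtain ⟨m, hm, hmax⟩ := R.exists_max_image h hR.nonempty
  let σ : V →ᵃ[ℝ] ℝ := AffineMap.const ℝ _ (h m) - h
  have hσ : ∀ c, σ c = h m - h c := fun c => by simp [σ]
  have hσlin : σ.linear = - h.linear := by simp [σ]
  have hs : Supports σ R :=
    ⟨by rwa [hσlin, Ne, neg_eq_zero], fun c hc => by rw [hσ]; linarith [hmax c hc]⟩
  obtain ⟨f, hf⟩ : ∃ f : V →ₗ[ℝ] ℝ, f ∉ Submodule.span ℝ {h.linear} := by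
    by_contra! hall
    have h1 : Submodule.span ℝ {h.linear} = ⊤ := eq_top_iff.2 fun f _ => hall f
    have h2 := finrank_span_singleton (K := ℝ) hh
    rw [h1, finrank_top, Subspace.dual_finrank_eq] at h2
    omega
  -- Minimising `f` on the top level of `h` and tilting by `σ` gives a supporting functional that
  -- vanishes at `z` and at some point `r` of a lower level.
  obtain ⟨z, hz, hmin⟩ := (R.filter (σ · = 0)).exists_min_image f
    ⟨m, Finset.mem_filter.2 ⟨hm, by rw [hσ, sub_self]⟩⟩
  obtain ⟨hzR, hz0⟩ := Finset.mem_filter.1 hz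
  let φ : V →ᵃ[ℝ] ℝ := f.toAffineMap - AffineMap.const ℝ V (f z)
  have hφ : ∀ c, φ c = f c - f z := fun c => by simp [φ]
  obtain ⟨t, ⟨r, hr, hr', hr0⟩, hpos⟩ := exists_tilt hs.2 (hR.exists_pos hs) (φ := φ)
    fun c hc h0 => by rw [hφ]; linarith [hmin c (Finset.mem_filter.2 ⟨hc, h0⟩)]
  have hg₀ : Supports (φ + t • σ) R := by
    refine ⟨fun h0 => hf ?_, fun c hc => by simpa using hpos c hc⟩
    have : f = t • h.linear := by
      simp [φ, hσlin] at h0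
      exact sub_eq_zero.1 (by rw [sub_eq_add_neg]; exact h0)
    rw [this]
    exact Submodule.smul_mem _ _ (Submodule.mem_span_singleton_self _)
  obtain ⟨g, hg, hgz⟩ := exists_facet hR hg₀
  refine ⟨g, hg, z, hzR, r, hr, hgz z hzR (by simp [hz0, hφ]), hgz r hr (by simpa using hr0), ?_⟩
  rw [hσ] at hz0 hr'
  intro h0
  linarith

end FourSpace

/-! ### Dimension 4: the seven points off a facet form a pyramid over an octahedron -/

open Classical

section FourSpace

variable {A : Finset (Fin 4 → ℝ)} {h g : (Fin 4 → ℝ) →ᵃ[ℝ] ℝ}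

/-- The two alternatives for the facet next to `g` opposite to its vertex `f`. -/
theorem rotate_facet (hA : ¬ IsTShaped (A : Set (Fin 4 → ℝ))) (hcard : A.card ≤ 11)
    (hh : Supports h A) (hh4 : 4 ≤ (A.filter (h · = 0)).card) {R G X : Finset (Fin 4 → ℝ)}
    (hR : R = A.filter (0 < h ·)) (hG : G = R.filter (g · = 0)) (hX : X = R.filter (0 < g ·))
    (hg : IsFacet g R) (hG4 : G.card = 4) (hX3 : X.card = 3) {s : ℝ} (hs : ∀ x ∈ X, h x = s)
    {f : Fin 4 → ℝ} (hf : f ∈ G) :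
    (∀ c ∈ G, c ≠ f → h c = s) ∨
    (h f = s ∧ ∃ g' : (Fin 4 → ℝ) →ᵃ[ℝ] ℝ, ∃ r ∈ X, g' f = 1 ∧ g' r = 0 ∧
      (∀ c ∈ G, c ≠ f → g' c = 0) ∧ ∀ x ∈ X, x ≠ r → g' x = 1) := by
  have hGR : ∀ c, c ∈ G ↔ c ∈ R ∧ g c = 0 := fun c => by rw [hG, Finset.mem_filter]
  have hXR : ∀ c, c ∈ X ↔ c ∈ R ∧ 0 < g c := fun c => by rw [hX, Finset.mem_filter]
  obtain ⟨φ, hφf, hφ⟩ := hg.exists_dual (by rw [← hG, hG4]; simp) ((hGR f).1 hf).1 ((hGR f).1 hf).2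
  obtain ⟨x₀, hx₀⟩ : X.Nonempty := Finset.card_pos.1 (by omega)
  obtain ⟨t, ⟨r, hrR, hr', hr0⟩, hpos⟩ := exists_tilt hg.1.2 (R := R) (σ := g) (φ := φ)
    ⟨x₀, (hXR _).1 hx₀⟩ (fun c hc h0 => by
      by_cases hcf : c = f
      · rw [hcf, hφf]; exact zero_le_one
      · exact (hφ c hc h0 hcf).ge)
  have hrX := (hXR r).2 ⟨hrR, hr'⟩
  have hval : ∀ c, (φ + t • g) c = φ c + t * g c := fun c => by simp
  generalize φ + t • g = g' at hval
  have hf1 : g' f = 1 := by rw [hval, hφf, ((hGR f).1 hf).2]; ring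
  have hr1 : g' r = 0 := by rw [hval, hr0]
  have hG1 : ∀ c ∈ G, c ≠ f → g' c = 0 := fun c hc hcf => by
    rw [hval, hφ c ((hGR c).1 hc).1 ((hGR c).1 hc).2 hcf, ((hGR c).1 hc).2]; ring
  have hpos' : ∀ c ∈ R, 0 ≤ g' c := fun c hc => by rw [hval]; exact hpos c hc
  have hlin : g'.linear ≠ 0 := fun h0 => by
    have := affineMap_const h0 f r
    rw [hf1, hr1] at this
    exact one_ne_zero this
  -- If independent, `second_face` applies to `g'`: its zeros are `r` and `G` without `f`, and both
  -- functionals are constant on `f` and the rest of `X`. If dependent, `h` is constant on the zeros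
  -- of `g'`.
  by_cases hli : LinearIndependent ℝ ![g'.linear, h.linear]
  · right
    have hrG : r ∉ G := fun h0 => hr'.ne' ((hGR r).1 h0).2
    have hsub : insert r (G.erase f) ⊆ R.filter (g' · = 0) := by
      intro c hc
      rcases Finset.mem_insert.1 hc with rfl | hc
      · exact Finset.mem_filter.2 ⟨hrR, hr1⟩
      · obtain ⟨hcf, hcG⟩ := Finset.mem_erase.1 hc
        exact Finset.mem_filter.2 ⟨((hGR c).1 hcG).1, hG1 c hcG hcf⟩
    have hins : (insert r (G.erase f)).card = 4 := by
      rw [Finset.card_insert_of_notMem (fun h0 => hrG (Finset.mem_of_mem_erase h0)),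
        Finset.card_erase_of_mem hf, hG4]
    subst hR
    obtain ⟨h4, -, s', u', hs', hu', hsu⟩ := second_face hA hcard hh hh4 hli hpos'
      (hins.ge.trans (Finset.card_le_card hsub))
    have heq := Finset.eq_of_subset_of_card_le hsub (by rw [h4, hins])
    have hmem : ∀ c ∈ A.filter (0 < h ·), c ∉ insert r (G.erase f) → h c = s' ∧ g' c = u' := by
      intro c hc hc'
      refine hsu c (Finset.mem_filter.2 ⟨hc, lt_of_le_of_ne (hpos' c hc) fun h0 => hc' ?_⟩)
      rw [heq]
      exact Finset.mem_filter.2 ⟨hc, h0.symm⟩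
    have hff := hmem f ((hGR f).1 hf).1 (by
      simp only [Finset.mem_insert, Finset.mem_erase, ne_eq, not_true_eq_false, false_and, or_false]
      rintro rfl
      exact hrG hf)
    have hxx : ∀ x ∈ X, x ≠ r → h x = s' ∧ g' x = u' := fun x hx hxr => by
      refine hmem x ((hXR x).1 hx).1 ?_
      simp only [Finset.mem_insert, Finset.mem_erase, not_or]
      exact ⟨hxr, fun h0 => ((hXR x).1 hx).2.ne' ((hGR x).1 h0.2).2⟩
    obtain ⟨x₁, hx₁⟩ : (X.erase r).Nonempty := Finset.card_pos.1 (by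
      rw [Finset.card_erase_of_mem hrX]; omega)
    obtain ⟨hx₁r, hx₁X⟩ := Finset.mem_erase.1 hx₁
    refine ⟨?_, g', r, hrX, hf1, hr1, hG1, fun x hx hxr => ?_⟩
    · rw [hff.1, ← (hxx x₁ hx₁X hx₁r).1, hs x₁ hx₁X]
    · rw [(hxx x hx hxr).2, ← hff.2, hf1]
  · left
    intro c hc hcf
    rw [apply_eq_of_not_linearIndependent hlin hli ((hG1 c hc hcf).trans hr1.symm), hs r hrX]

/-- Four functionals separate points if suitable test points are triangular for them. -/
theorem eq_of_four_functionals {h g g₁ g₂ : (Fin 4 → ℝ) →ᵃ[ℝ] ℝ} {p a₁ a₂ a₃ b : Fin 4 → ℝ}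
    {s u : ℝ} (hp : h p ≠ s) (ha₁ : h a₁ = s) (ha₂ : h a₂ = s) (ha₃ : h a₃ = s) (hb : h b = s)
    (gp : g p = 0) (ga₁ : g a₁ = 0) (ga₂ : g a₂ = 0) (ga₃ : g a₃ = 0) (gb : g b = u) (hu : u ≠ 0)
    (g₁p : g₁ p = 0) (g₁a₁ : g₁ a₁ = 1) (g₁a₂ : g₁ a₂ = 0) (g₁a₃ : g₁ a₃ = 0)
    (g₂p : g₂ p = 0) (g₂a₁ : g₂ a₁ = 0) (g₂a₂ : g₂ a₂ = 1) (g₂a₃ : g₂ a₃ = 0)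
    {x y : Fin 4 → ℝ} (e₀ : h x = h y) (e : g x = g y) (e₁ : g₁ x = g₁ y) (e₂ : g₂ x = g₂ y) :
    x = y := by
  have hli : LinearIndependent ℝ ![h.linear, g.linear, g₁.linear, g₂.linear] := by
    rw [Fintype.linearIndependent_iff]
    intro w hw
    have key : ∀ x y, w 0 * (h x - h y) + w 1 * (g x - g y) + w 2 * (g₁ x - g₁ y) +
        w 3 * (g₂ x - g₂ y) = 0 := by
      intro x y
      have := congrArg (fun φ : (Fin 4 → ℝ) →ₗ[ℝ] ℝ => φ (x - y)) hw
      simp only [Fin.sum_univ_four] at this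
      rw [affineMap_sub, affineMap_sub, affineMap_sub, affineMap_sub]
      exact this
    have k0 := key p a₃
    rw [ha₃, gp, ga₃, g₁p, g₁a₃, g₂p, g₂a₃] at k0
    have w0 : w 0 = 0 := by
      have : w 0 * (h p - s) = 0 := by linarith
      exact (mul_eq_zero.1 this).resolve_right (sub_ne_zero.2 hp)
    have k1 := key a₁ a₃
    rw [ha₁, ha₃, ga₁, ga₃, g₁a₁, g₁a₃, g₂a₁, g₂a₃] at k1
    have w2 : w 2 = 0 := by linarith
    have k2 := key a₂ a₃
    rw [ha₂, ha₃, ga₂, ga₃, g₁a₂, g₁a₃, g₂a₂, g₂a₃] at k2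
    have w3 : w 3 = 0 := by linarith
    have k3 := key b a₃
    rw [hb, ha₃, gb, ga₃, w0, w2, w3] at k3
    have w1 : w 1 = 0 := by
      have : w 1 * u = 0 := by linarith
      exact (mul_eq_zero.1 this).resolve_right hu
    intro i
    fin_cases i <;> assumption
  refine sub_eq_zero.1 (eq_zero_of_linearIndependent_dual hli (by simp) fun i => ?_)
  fin_cases i
  · exact (affineMap_sub h x y).symm.trans (sub_eq_zero.2 e₀)
  · exact (affineMap_sub g x y).symm.trans (sub_eq_zero.2 e)
  · exact (affineMap_sub g₁ x y).symm.trans (sub_eq_zero.2 e₁)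
  · exact (affineMap_sub g₂ x y).symm.trans (sub_eq_zero.2 e₂)

theorem affineMap_add_sub {V : Type*} [AddCommGroup V] [Module ℝ V] (g : V →ᵃ[ℝ] ℝ) (x y z : V) :
    g (x + y - z) = g x + g y - g z := by
  rw [affineMap_eq g (x + y - z), affineMap_eq g x, affineMap_eq g y, affineMap_eq g z, map_sub,
    map_add]
  ring

/-- After removing a face with at least four points from a set of at most eleven points that is
not T-shaped, a pyramid over an octahedron is left, with its base parallel to that face. -/
theorem exists_octahedron (hA : ¬ IsTShaped (A : Set (Fin 4 → ℝ))) (hcard : A.card ≤ 11)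
    (hh : Supports h A) (hh4 : 4 ≤ (A.filter (h · = 0)).card) :
    ∃ (s : ℝ) (p c : Fin 4 → ℝ) (O : Finset (Fin 4 → ℝ)), O.card = 6 ∧ p ∉ O ∧
      A.filter (0 < h ·) = insert p O ∧ 0 < s ∧ s < h p ∧ (∀ x ∈ O, h x = s) ∧
      ∀ x ∈ O, c - x ∈ O := by
  have hspan := spanning_pos hA hcard hh hh4
  obtain ⟨g, hg, z, hz, z', hz', gz, gz', hzz'⟩ :=
    exists_transversal_facet (by simp) hspan hh.1
  have hli := linearIndependent_pair_of_apply hg.1.1 (gz.trans gz'.symm) hzz'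
  have hcl := hg.finrank_le_card
  rw [finrank_fintype_fun_eq_card, Fintype.card_fin] at hcl
  obtain ⟨hG4, hX3, s, u, hs, hu, hsu⟩ := second_face hA hcard hh hh4 hli hg.1.2 hcl
  obtain ⟨R, hR⟩ : ∃ R, R = A.filter (0 < h ·) := ⟨_, rfl⟩
  rw [← hR] at hspan hg hz hz' hcl hG4 hX3 hsu ⊢
  obtain ⟨G, hG⟩ : ∃ G, G = R.filter (g · = 0) := ⟨_, rfl⟩
  obtain ⟨X, hX⟩ : ∃ X, X = R.filter (0 < g ·) := ⟨_, rfl⟩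
  rw [← hG] at hG4 hcl
  rw [← hX] at hX3 hsu
  have hGR : ∀ c, c ∈ G ↔ c ∈ R ∧ g c = 0 := fun c => by rw [hG, Finset.mem_filter]
  have hXR : ∀ c, c ∈ X ↔ c ∈ R ∧ 0 < g c := fun c => by rw [hX, Finset.mem_filter]
  have hrot := fun f (hf : f ∈ G) =>
    rotate_facet hA hcard hh hh4 hR hG hX hg hG4 hX3 (fun x hx => (hsu x hx).1) hf
  -- This is the apex: rotating `g` about any other vertex of `G` rules out the first alternative of
  -- `rotate_facet`, so that vertex has height `s`.
  obtain ⟨p, hpG, hps⟩ : ∃ p ∈ G, h p ≠ s := by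
    by_contra! hall
    exact hzz' ((hall z ((hGR z).2 ⟨hz, gz⟩)).trans (hall z' ((hGR z').2 ⟨hz', gz'⟩)).symm)
  have hGs : ∀ c ∈ G, c ≠ p → h c = s := fun c hc hcp => by
    rcases hrot c hc with h1 | h1
    · exact absurd (h1 p hpG hcp.symm) hps
    · exact h1.1
  have hRs : ∀ c ∈ R, c ≠ p → h c = s := fun c hc hcp => by
    rcases (hg.1.2 c hc).eq_or_lt with h0 | h0
    · exact hGs c ((hGR c).2 ⟨hc, h0.symm⟩) hcp
    · exact (hsu c ((hXR c).2 ⟨hc, h0⟩)).1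
  have hpR := ((hGR p).1 hpG).1
  have hRcard : R.card = 7 := by
    have := card_pos_add_card_zero hg.1.2
    rw [← hG, ← hX] at this
    omega
  have hOcard : (R.erase p).card = 6 := by rw [Finset.card_erase_of_mem hpR, hRcard]
  have hRA : ∀ c, c ∈ R ↔ c ∈ A ∧ 0 < h c := fun c => by rw [hR, Finset.mem_filter]
  -- Otherwise `s - h` would support `A` with at least six zeros, leaving at most five points where
  -- seven are needed.
  have hsp : s < h p := by
    refine lt_of_le_of_ne (le_of_not_gt fun hlt => ?_) (Ne.symm hps)
    let σ : (Fin 4 → ℝ) →ᵃ[ℝ] ℝ := AffineMap.const ℝ _ s - h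
    have hσ : ∀ c, σ c = s - h c := fun c => by simp [σ]
    have hσs : Supports σ A := by
      refine ⟨fun h0 => hh.1 ?_, fun c hc => ?_⟩
      · have : σ.linear = - h.linear := by simp [σ]
        rwa [this, neg_eq_zero] at h0
      · rw [hσ]
        rcases (hh.2 c hc).eq_or_lt with h0 | h0
        · linarith
        · by_cases hcp : c = p
          · subst hcp; linarith
          · rw [hRs c ((hRA c).2 ⟨hc, h0⟩) hcp, sub_self]
    have h7 := (seven_le_card_pos hA hcard hσs).1
    have hz := card_pos_add_card_zero hσs.2
    have hsub : R.erase p ⊆ A.filter (σ · = 0) := fun c hc => by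
      obtain ⟨hcp, hcR⟩ := Finset.mem_erase.1 hc
      exact Finset.mem_filter.2 ⟨((hRA c).1 hcR).1, by rw [hσ, hRs c hcR hcp, sub_self]⟩
    have := Finset.card_le_card hsub
    omega
  have hrot' : ∀ f ∈ G, f ≠ p → ∃ g' : (Fin 4 → ℝ) →ᵃ[ℝ] ℝ, ∃ r ∈ X, g' f = 1 ∧ g' r = 0 ∧
      (∀ c ∈ G, c ≠ f → g' c = 0) ∧ ∀ x ∈ X, x ≠ r → g' x = 1 := fun f hf hfp => by
    rcases hrot f hf with h1 | h1
    · exact absurd (h1 p hpG hfp.symm) hps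
    · exact h1.2
  obtain ⟨a₁, a₂, a₃, h12, h13, h23, hGe⟩ :=
    Finset.card_eq_three.1 (by rw [Finset.card_erase_of_mem hpG, hG4] : (G.erase p).card = 3)
  have hmemG : ∀ {c}, c ∈ ({a₁, a₂, a₃} : Finset (Fin 4 → ℝ)) → c ≠ p ∧ c ∈ G := fun {c} hc => by
    rw [← hGe] at hc
    exact Finset.mem_erase.1 hc
  obtain ⟨hp1, hG1⟩ := hmemG (c := a₁) (by simp)
  obtain ⟨hp2, hG2⟩ := hmemG (c := a₂) (by simp)
  obtain ⟨hp3, hG3⟩ := hmemG (c := a₃) (by simp)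
  obtain ⟨g₁, r₁, hr₁, g₁a₁, g₁r₁, g₁G, g₁X⟩ := hrot' a₁ hG1 hp1
  obtain ⟨g₂, r₂, hr₂, g₂a₂, g₂r₂, g₂G, g₂X⟩ := hrot' a₂ hG2 hp2
  have hsep : ∀ {x y : Fin 4 → ℝ}, h x = h y → g x = g y → g₁ x = g₁ y → g₂ x = g₂ y → x = y :=
    fun {x y} e₀ e e₁ e₂ => eq_of_four_functionals hps (hGs _ hG1 hp1) (hGs _ hG2 hp2)
      (hGs _ hG3 hp3) (hsu _ hr₁).1 ((hGR _).1 hpG).2 ((hGR _).1 hG1).2 ((hGR _).1 hG2).2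
      ((hGR _).1 hG3).2 (hsu _ hr₁).2 hu.ne' (g₁G p hpG hp1.symm) g₁a₁ (g₁G _ hG2 h12.symm)
      (g₁G _ hG3 h13.symm) (g₂G p hpG hp2.symm) (g₂G _ hG1 h12) g₂a₂ (g₂G _ hG3 h23.symm) e₀ e e₁ e₂
  have hr12 : r₁ ≠ r₂ := by
    intro heq
    obtain ⟨x, y, hxy, hXe⟩ := Finset.card_eq_two.1
      (by rw [Finset.card_erase_of_mem hr₁, hX3] : (X.erase r₁).card = 2)
    have hx : x ∈ X.erase r₁ := by rw [hXe]; simp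
    have hy : y ∈ X.erase r₁ := by rw [hXe]; simp
    obtain ⟨hxr, hxX⟩ := Finset.mem_erase.1 hx
    obtain ⟨hyr, hyX⟩ := Finset.mem_erase.1 hy
    refine hxy (hsep ?_ ?_ ?_ ?_)
    · rw [(hsu x hxX).1, (hsu y hyX).1]
    · rw [(hsu x hxX).2, (hsu y hyX).2]
    · rw [g₁X x hxX hxr, g₁X y hyX hyr]
    · rw [g₂X x hxX (heq ▸ hxr), g₂X y hyX (heq ▸ hyr)]
  obtain ⟨r₃, hr₃e⟩ := Finset.card_eq_one.1
    (by rw [Finset.card_erase_of_mem (Finset.mem_erase.2 ⟨hr12.symm, hr₂⟩),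
      Finset.card_erase_of_mem hr₁, hX3] : ((X.erase r₁).erase r₂).card = 1)
  have hr₃' : r₃ ∈ (X.erase r₁).erase r₂ := by rw [hr₃e]; simp
  simp only [Finset.mem_erase] at hr₃'
  obtain ⟨hr32, hr31, hr₃⟩ := hr₃'
  -- The four functionals `h`, `g`, `g₁`, `g₂` are affine coordinates, so comparing values shows
  -- that the pairs aᵢ, rᵢ have a common midpoint.
  have s12 : a₁ + r₁ - a₂ = r₂ := by
    apply hsep <;> rw [affineMap_add_sub]
    · rw [hGs _ hG1 hp1, hGs _ hG2 hp2, (hsu _ hr₁).1, (hsu _ hr₂).1]; ring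
    · rw [((hGR _).1 hG1).2, ((hGR _).1 hG2).2, (hsu _ hr₁).2, (hsu _ hr₂).2]; ring
    · rw [g₁a₁, g₁r₁, g₁G _ hG2 h12.symm, g₁X _ hr₂ hr12.symm]; ring
    · rw [g₂G _ hG1 h12, g₂X _ hr₁ hr12, g₂a₂, g₂r₂]; ring
  have s13 : a₁ + r₁ - a₃ = r₃ := by
    apply hsep <;> rw [affineMap_add_sub]
    · rw [hGs _ hG1 hp1, hGs _ hG3 hp3, (hsu _ hr₁).1, (hsu _ hr₃).1]; ring
    · rw [((hGR _).1 hG1).2, ((hGR _).1 hG3).2, (hsu _ hr₁).2, (hsu _ hr₃).2]; ring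
    · rw [g₁a₁, g₁r₁, g₁G _ hG3 h13.symm, g₁X _ hr₃ hr31]; ring
    · rw [g₂G _ hG1 h12, g₂X _ hr₁ hr12, g₂G _ hG3 h23.symm, g₂X _ hr₃ hr32]; ring
  have hGO : ∀ c ∈ G, c ≠ p → c ∈ R.erase p := fun c hc hcp =>
    Finset.mem_erase.2 ⟨hcp, ((hGR c).1 hc).1⟩
  have hXO : ∀ c ∈ X, c ∈ R.erase p := fun c hc =>
    Finset.mem_erase.2 ⟨fun h0 => hps (h0 ▸ (hsu c hc).1), ((hXR c).1 hc).1⟩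
  refine ⟨s, p, a₁ + r₁, R.erase p, hOcard, Finset.notMem_erase _ _,
    (Finset.insert_erase hpR).symm, hs, hsp, fun x hx => ?_, fun x hx => ?_⟩
  · exact hRs x (Finset.mem_of_mem_erase hx) (Finset.ne_of_mem_erase hx)
  · obtain ⟨hxp, hxR⟩ := Finset.mem_erase.1 hx
    rcases (hg.1.2 x hxR).eq_or_lt with h0 | h0
    · have : x ∈ G.erase p := Finset.mem_erase.2 ⟨hxp, (hGR x).2 ⟨hxR, h0.symm⟩⟩
      rw [hGe] at this
      simp only [Finset.mem_insert, Finset.mem_singleton] at this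
      rcases this with rfl | rfl | rfl
      · rw [add_sub_cancel_left]; exact hXO _ hr₁
      · rw [s12]; exact hXO _ hr₂
      · rw [s13]; exact hXO _ hr₃
    · have hxX := (hXR x).2 ⟨hxR, h0⟩
      by_cases hx1 : x = r₁
      · rw [hx1, add_sub_cancel_right]; exact hGO _ hG1 hp1
      by_cases hx2 : x = r₂
      · rw [hx2, ← s12, sub_sub_cancel]; exact hGO _ hG2 hp2
      have : x ∈ (X.erase r₁).erase r₂ :=
        Finset.mem_erase.2 ⟨hx2, Finset.mem_erase.2 ⟨hx1, hxX⟩⟩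
      rw [hr₃e, Finset.mem_singleton] at this
      rw [this, ← s13, sub_sub_cancel]; exact hGO _ hG3 hp3

end FourSpace

/-! ### Dimension 4: comparing adjacent facets excludes eleven points -/

theorem two_smul_sum_of_symmetric {V : Type*} [AddCommGroup V] {E : Finset V} {c : V}
    (hE : ∀ y ∈ E, c - y ∈ E) : 2 • ∑ y ∈ E, y = E.card • c := by
  have h1 : ∑ y ∈ E, y = ∑ y ∈ E, (c - y) :=
    Finset.sum_nbij' (fun y => c - y) (fun y => c - y) hE hE (fun y _ => sub_sub_cancel c y)
      (fun y _ => sub_sub_cancel c y) (fun y _ => (sub_sub_cancel c y).symm)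
  rw [Finset.sum_sub_distrib, Finset.sum_const] at h1
  rw [two_nsmul]
  nth_rewrite 1 [h1]
  rw [sub_add_cancel]

theorem affineMap_apply_sub {V : Type*} [AddCommGroup V] [Module ℝ V] (g : V →ᵃ[ℝ] ℝ) (c y : V) :
    g (c - y) = g c + g 0 - g y := by
  rw [← affineMap_add_sub, add_zero]

section FourSpace

variable {A : Finset (Fin 4 → ℝ)} {h : (Fin 4 → ℝ) →ᵃ[ℝ] ℝ}

/-- The apex of the remaining pyramid is symmetric to every vertex of the removed facet. -/
theorem apex_add_vertex (hA : ¬ IsTShaped (A : Set (Fin 4 → ℝ))) (hcard : A.card ≤ 11)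
    (hh : IsFacet h A) (hF4 : (A.filter (h · = 0)).card = 4)
    {s : ℝ} {p c : Fin 4 → ℝ} {O : Finset (Fin 4 → ℝ)} (hO6 : O.card = 6) (hpO : p ∉ O)
    (hRO : A.filter (0 < h ·) = insert p O) (hs : 0 < s) (hsp : s < h p)
    (hOs : ∀ x ∈ O, h x = s) (hOc : ∀ x ∈ O, c - x ∈ O)
    {f : Fin 4 → ℝ} (hfA : f ∈ A) (hf0 : h f = 0) : p + f = c := by
  have hmemR : ∀ y, y ∈ A ∧ 0 < h y ↔ y = p ∨ y ∈ O := fun y => by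
    rw [← Finset.mem_insert, ← hRO, Finset.mem_filter]
  obtain ⟨φ, hφf, hφ⟩ := hh.exists_dual (by rw [hF4]; simp) hfA hf0
  have hpA := (hmemR p).2 (Or.inl rfl)
  obtain ⟨t, ⟨x, hxA, hx', hx0⟩, hpos⟩ := exists_tilt hh.1.2 (R := A) (σ := h) (φ := φ)
    ⟨p, hpA⟩ (fun c hc h0 => by
      by_cases hcf : c = f
      · rw [hcf, hφf]; exact zero_le_one
      · exact (hφ c hc h0 hcf).ge)
  have hval : ∀ c, (φ + t • h) c = φ c + t * h c := fun c => by simp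
  generalize φ + t • h = H at hval
  have hHf : H f = 1 := by rw [hval, hφf, hf0]; ring
  have hHx : H x = 0 := by rw [hval, hx0]
  have hHF : ∀ y ∈ A, h y = 0 → y ≠ f → H y = 0 := fun y hy h0 hyf => by
    rw [hval, hφ y hy h0 hyf, h0]; ring
  have hHs : Supports H A := by
    refine ⟨fun h0 => ?_, fun c hc => by rw [hval]; exact hpos c hc⟩
    have := affineMap_const h0 f x
    rw [hHf, hHx] at this
    exact one_ne_zero this
  have hfF : f ∈ A.filter (h · = 0) := Finset.mem_filter.2 ⟨hfA, hf0⟩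
  have hsub : insert x ((A.filter (h · = 0)).erase f) ⊆ A.filter (H · = 0) := by
    intro y hy
    rcases Finset.mem_insert.1 hy with rfl | hy
    · exact Finset.mem_filter.2 ⟨hxA, hHx⟩
    · obtain ⟨hyf, hyF⟩ := Finset.mem_erase.1 hy
      obtain ⟨hyA, hy0⟩ := Finset.mem_filter.1 hyF
      exact Finset.mem_filter.2 ⟨hyA, hHF y hyA hy0 hyf⟩
  have hins : (insert x ((A.filter (h · = 0)).erase f)).card = 4 := by
    rw [Finset.card_insert_of_notMem, Finset.card_erase_of_mem hfF, hF4]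
    intro h0
    exact hx'.ne' (Finset.mem_filter.1 (Finset.mem_of_mem_erase h0)).2
  have h4le := hins.ge.trans (Finset.card_le_card hsub)
  have heq := Finset.eq_of_subset_of_card_le hsub (by
    have h1 := (seven_le_card_pos hA hcard hHs).1
    have h2 := card_pos_add_card_zero hHs.2
    omega)
  obtain ⟨S, p', c', O', -, hpO', hRO', hS, hSp', hOS', hOc'⟩ :=
    exists_octahedron hA hcard hHs h4le
  have hmemR' : ∀ y, y ∈ A ∧ 0 < H y ↔ y = p' ∨ y ∈ O' := fun y => by
    rw [← Finset.mem_insert, ← hRO', Finset.mem_filter]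
  have hHpos : ∀ y ∈ A, 0 < h y → y ≠ x → 0 < H y := fun y hy h0 hyx => by
    refine lt_of_le_of_ne (hHs.2 y hy) fun hy0 => ?_
    have : y ∈ insert x ((A.filter (h · = 0)).erase f) := heq ▸ Finset.mem_filter.2 ⟨hy, hy0.symm⟩
    rcases Finset.mem_insert.1 this with h1 | h1
    · exact hyx h1
    · exact h0.ne' (Finset.mem_filter.1 (Finset.mem_of_mem_erase h1)).2
  have hOA : ∀ y ∈ O, y ≠ x → y = p' ∨ y ∈ O' := fun y hy hyx => by
    obtain ⟨h1, h2⟩ := (hmemR y).2 (Or.inr hy)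
    exact (hmemR' y).1 ⟨h1, hHpos y h1 h2 hyx⟩
  have hOS : ∀ y ∈ O, y ≠ x → S ≤ H y := fun y hy hyx => by
    rcases hOA y hy hyx with h1 | h1
    · rw [h1]; exact hSp'.le
    · exact (hOS' y h1).ge
  obtain ⟨κ, hκ⟩ : ∃ κ, ∀ y, H (c - y) = κ - H y := ⟨_, fun y => affineMap_apply_sub H c y⟩
  -- At most four of the six points of `O` are excluded, so some `z` and its reflection `c - z` both
  -- lie in `O'`, at level `S` of `H`.
  have hκS : κ = 2 * S := by
    obtain ⟨z, hz, hz'⟩ := Finset.exists_mem_notMem_of_card_lt_card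
      (s := ({x, c - x, p', c - p'} : Finset (Fin 4 → ℝ))) (t := O)
      (lt_of_le_of_lt Finset.card_le_four (by omega))
    simp only [Finset.mem_insert, Finset.mem_singleton, not_or] at hz'
    obtain ⟨z1, z2, z3, z4⟩ := hz'
    have e1 := hOS' z ((hOA z hz z1).resolve_left z3)
    have e2 := hOS' (c - z) ((hOA _ (hOc z hz) fun h0 => z2 (by rw [← h0, sub_sub_cancel])).resolve_left
      fun h0 => z4 (by rw [← h0, sub_sub_cancel]))
    rw [hκ] at e2
    linarith
  have hHO : ∀ y ∈ O, y ≠ x → c - y ≠ x → H y = S := fun y hy h1 h2 => by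
    have e1 := hOS y hy h1
    have e2 := hOS _ (hOc y hy) h2
    rw [hκ] at e2
    linarith
  have hxpO := (hmemR x).1 ⟨hxA, hx'⟩
  rcases hxpO with rfl | hxO
  · exfalso
    have hne : h x - s ≠ 0 := by linarith
    -- If `x` is the apex, `H` is an affine function of `h` on the pyramid, hence everywhere by
    -- spanning. This fails at another vertex `f'` of the first facet, where both vanish.
    let D : (Fin 4 → ℝ) →ᵃ[ℝ] ℝ := (h x - s) • H + S • h - AffineMap.const ℝ _ (S * h x)
    have hD : ∀ y, D y = (h x - s) * H y + S * h y - S * h x := fun y => by simp [D]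
    have hD0 : D.linear = 0 := by
      refine spanning_pos hA hcard hh.1 hF4.ge D fun y hy => ?_
      rw [hRO] at hy
      rw [hD]
      rcases Finset.mem_insert.1 hy with rfl | hyO
      · rw [hHx]; ring
      · rw [hHO y hyO (fun h0 => hpO (h0 ▸ hyO)) (fun h0 => hpO (h0 ▸ hOc y hyO)), hOs y hyO]; ring
    obtain ⟨f', hf'⟩ : ((A.filter (h · = 0)).erase f).Nonempty := Finset.card_pos.1 (by
      rw [Finset.card_erase_of_mem hfF]; omega)
    obtain ⟨hff, hf'F⟩ := Finset.mem_erase.1 hf'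
    obtain ⟨hf'A, hf'0⟩ := Finset.mem_filter.1 hf'F
    have := affineMap_const hD0 f' x
    rw [hD, hD, hHx, hHF f' hf'A hf'0 hff, hf'0] at this
    have h3 : 0 < S * h x := mul_pos hS (by linarith)
    linarith
  have hx'O := hOc x hxO
  have hHx' : H (c - x) = 2 * S := by rw [hκ, hHx, hκS, sub_zero]
  have hx'x : c - x ≠ x := fun h0 => by rw [h0, hHx] at hHx'; linarith
  -- The reflection of `x` has level `2 * S`, above the base of the second pyramid, so it is that
  -- pyramid's apex.
  have hx'p : c - x = p' := (hOA _ hx'O hx'x).resolve_right fun h0 => by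
    have := hOS' _ h0
    linarith
  have hfO' : f ∈ O' := ((hmemR' f).1 ⟨hfA, by rw [hHf]; exact one_pos⟩).resolve_left fun h0 => by
    have := hOs _ hx'O
    rw [hx'p, ← h0] at this
    linarith
  have hpO'' : p ∈ O' :=
    ((hmemR' p).1 ⟨hpA.1, hHpos p hpA.1 hpA.2 fun h0 => hpO (h0 ▸ hxO)⟩).resolve_left
      fun h0 => hpO (by rw [h0, ← hx'p]; exact hx'O)
  have hO'sub : ∀ y ∈ O', y = f ∨ y = p ∨ (y ∈ O ∧ y ≠ x ∧ y ≠ c - x) := fun y hy => by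
    obtain ⟨hyA, hyH⟩ := (hmemR' y).2 (Or.inr hy)
    by_cases hyf : y = f
    · exact Or.inl hyf
    rcases (hh.1.2 y hyA).eq_or_lt with h0 | h0
    · exact absurd (hHF y hyA h0.symm hyf) hyH.ne'
    · rcases (hmemR y).1 ⟨hyA, h0⟩ with h1 | h1
      · exact Or.inr (Or.inl h1)
      · refine Or.inr (Or.inr ⟨h1, fun h2 => ?_, fun h2 => ?_⟩)
        · rw [h2, hHx] at hyH; exact lt_irrefl _ hyH
        · exact hpO' (by rw [← hx'p, ← h2]; exact hy)
  obtain ⟨τ, hτ⟩ : ∃ τ, ∀ y, h (c' - y) = τ - h y := ⟨_, fun y => affineMap_apply_sub h c' y⟩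
  have hO'0 : ∀ y ∈ O', 0 ≤ h y := fun y hy => hh.1.2 y ((hmemR' y).2 (Or.inr hy)).1
  have hτp : h p ≤ τ := by
    have := hO'0 _ (hOc' p hpO'')
    rw [hτ] at this
    linarith
  -- Reflection in `O'` carries the lowest vertex `f` to height at least `h p`, and only `p` is that
  -- high.
  have hcf : c' - f = p := by
    have h1 := hτ f
    rcases hO'sub _ (hOc' f hfO') with h0 | h0 | ⟨h0, -⟩
    · rw [h0, hf0] at h1; linarith
    · exact h0
    · rw [hOs _ h0, hf0] at h1; linarith
  have hτeq : τ = h p := by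
    have := hτ f
    rw [hcf, hf0] at this
    linarith
  let E := (O.erase x).erase (c - x)
  have hE : ∀ y, y ∈ E ↔ y ∈ O ∧ y ≠ x ∧ y ≠ c - x := fun y => by
    simp only [E, Finset.mem_erase]; tauto
  have hE4 : E.card = 4 := by
    rw [Finset.card_erase_of_mem (Finset.mem_erase.2 ⟨hx'x, hx'O⟩), Finset.card_erase_of_mem hxO, hO6]
  have hEc : ∀ y ∈ E, c - y ∈ E := fun y hy => by
    obtain ⟨h1, h2, h3⟩ := (hE y).1 hy
    exact (hE _).2 ⟨hOc y h1, fun h0 => h3 (by rw [← h0, sub_sub_cancel]),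
      fun h0 => h2 (sub_right_injective h0)⟩
  have hEc' : ∀ y ∈ E, c' - y ∈ E := fun y hy => by
    obtain ⟨h1, h2, h3⟩ := (hE y).1 hy
    have hyO' := (hOA y h1 h2).resolve_left fun h0 => h3 (h0.trans hx'p.symm)
    have h4 := hτ y
    rw [hOs y h1, hτeq] at h4
    rcases hO'sub _ (hOc' y hyO') with h0 | h0 | h0
    · rw [h0, hf0] at h4; linarith
    · rw [h0] at h4; linarith
    · exact (hE _).2 h0
  -- The four common points `E` are symmetric under both reflections, so both centres are their
  -- centroid.
  have hcc : c = c' := by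
    have h1 := (two_smul_sum_of_symmetric hEc).symm.trans (two_smul_sum_of_symmetric hEc')
    rw [hE4] at h1
    exact smul_right_injective (Fin 4 → ℝ) (by norm_num : (4 : ℕ) ≠ 0) h1
  rw [hcc, ← hcf, sub_add_cancel]

theorem twelve_le_tNumber_four : ((12 : ℕ) : ℕ∞) ≤ tNumber 4 := by
  refine le_tNumber fun A hA => ?_
  by_contra! hlt
  have hcard : A.card ≤ 11 := by omega
  have hsp : Spanning A := spanning_of_not_isTShaped (m := 2) hA
  obtain ⟨g₀, hg₀⟩ := exists_supports hsp.nonempty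
  obtain ⟨h, hh, -⟩ := exists_facet hsp hg₀
  have h1 := (seven_le_card_pos hA hcard hh.1).1
  have h2 := card_pos_add_card_zero hh.1.2
  have h3 := hh.finrank_le_card
  rw [finrank_fintype_fun_eq_card, Fintype.card_fin] at h3
  have hF4 : (A.filter (h · = 0)).card = 4 := by omega
  obtain ⟨s, p, c, O, hO6, hpO, hRO, hs, hsp, hOs, hOc⟩ := exists_octahedron hA hcard hh.1 h3
  obtain ⟨f₁, hf₁, f₂, hf₂, hne⟩ := Finset.one_lt_card.1 (by rw [hF4]; norm_num :
    1 < (A.filter (h · = 0)).card)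
  obtain ⟨hf₁A, hf₁0⟩ := Finset.mem_filter.1 hf₁
  obtain ⟨hf₂A, hf₂0⟩ := Finset.mem_filter.1 hf₂
  exact hne (add_left_cancel
    ((apex_add_vertex hA hcard hh hF4 hO6 hpO hRO hs hsp hOs hOc hf₁A hf₁0).trans
      (apex_add_vertex hA hcard hh hF4 hO6 hpO hRO hs hsp hOs hOc hf₂A hf₂0).symm))

end FourSpace

/-! ### Bounds in all dimensions and conclusion -/

/-- A crude bound that secures the size hypothesis of `tNumber_add_succ_le` in every dimension from
4 on. -/
theorem add_five_le_tNumber (m : ℕ) : ((m + 5 : ℕ) : ℕ∞) ≤ tNumber (m + 3) := by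
  induction m with
  | zero => exact le_trans (by norm_num) six_le_tNumber_three
  | succ m ih => exact le_trans (by exact_mod_cast (by omega)) (tNumber_add_le (m := m + 2) ih)

theorem exists_tNumber_eq (n : ℕ) (hn : 1 ≤ n) : ∃ N : ℕ, (N : ℕ∞) = tNumber n :=
  ENat.ne_top_iff_exists.1 ((tNumber_le n hn).trans_lt (ENat.natCast_lt_top _)).ne

theorem tNumber_add_le_tNumber (n : ℕ) (hn : 4 ≤ n) :
    tNumber (n - 1) + (n : ℕ∞) + 1 ≤ tNumber n := by
  obtain ⟨m, rfl⟩ := Nat.exists_eq_add_of_le' hn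
  obtain ⟨N, hN⟩ := exists_tNumber_eq (m + 3) (by omega)
  have hlt : m + 5 ≤ N := by
    have := add_five_le_tNumber m
    rw [← hN] at this
    exact_mod_cast this
  have := tNumber_add_succ_le (m := m + 2) hN.le (by omega)
  change tNumber (m + 3) + _ + 1 ≤ _
  rw [← hN]
  exact_mod_cast this

theorem quadratic_le_tNumber (n : ℕ) (hn : 4 ≤ n) :
    (((n ^ 2 + 3 * n - 4) / 2 : ℕ) : ℕ∞) ≤ tNumber n := by
  induction n, hn using Nat.le_induction with
  | base => exact twelve_le_tNumber_four
  | succ n hn ih =>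
    refine le_trans ?_ (tNumber_add_le_tNumber (n + 1) (by omega))
    refine le_trans ?_ (add_le_add_left (add_le_add_left ih _) _)
    -- The numerator grows by 2n + 4, so the quotient grows by exactly n + 2.
    have : ((n + 1) ^ 2 + 3 * (n + 1) - 4) / 2 ≤ (n ^ 2 + 3 * n - 4) / 2 + (n + 1) + 1 := by
      have : (n + 1) ^ 2 = n ^ 2 + 2 * n + 1 := by ring
      omega
    exact_mod_cast this

theorem theorem4p3 :
    tNumber 1 = 1 ∧
    tNumber 2 = 3 ∧
    tNumber 3 = 6 ∧
    tNumber 4 = 12 ∧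
    (∀ n : ℕ, 1 ≤ n → tNumber n ≤ ((n ^ 2 - n + 1 : ℕ) : ℕ∞)) ∧
    (∀ n : ℕ, 4 ≤ n → tNumber (n - 1) + (n : ℕ∞) + 1 ≤ tNumber n) ∧
    (∀ n : ℕ, 4 ≤ n → (((n ^ 2 + 3 * n - 4) / 2 : ℕ) : ℕ∞) ≤ tNumber n) := by
  refine ⟨le_antisymm (tNumber_le 1 le_rfl) one_le_tNumber_one,
    le_antisymm (tNumber_le 2 (by norm_num)) (tNumber_add_le (m := 0) one_le_tNumber_one),
    le_antisymm tNumber_three_le six_le_tNumber_three,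
    le_antisymm tNumber_four_le twelve_le_tNumber_four,
    tNumber_le, tNumber_add_le_tNumber, quadratic_le_tNumber⟩
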